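/- Let $E\subset\mathbb R$ be a compact set whose Hausdorff dimension is greater than $3/4$. Put $$\Box(E)=\{\sqrt{|y-x|^2+|z-x|^2}\,:\ x,y,z\in E,\ y\neq z\},$$ and, for $x\in E$, $$\Box_x(E)=\{\sqrt{|y-x|^2+|z-x|^2}\,:\ y,z\in E,\ y\neq z\}.$$ Let $\mathcal L^1$ denote Lebesgue measure on $\mathbb R$. Then $\mathcal L^1(\Box(E))>0$. Moreover, there is a point $x\in E$ such that $\mathcal L^1(\Box_x(E))>0$. -/

import Mathlib

open MeasureTheory
open scoped ENNReal

/-- The pinned box set of `E ⊆ ℝ` at `x`: the Euclidean distances in the plane from `(x, x)` to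
the points `(y, z)` of `E × E` with `y ≠ z`. -/
def pinnedBoxSet (E : Set ℝ) (x : ℝ) : Set ℝ :=
  {t : ℝ | ∃ y ∈ E, ∃ z ∈ E, y ≠ z ∧ t = Real.sqrt (|y - x| ^ 2 + |z - x| ^ 2)}

/-- The box set of `E ⊆ ℝ`: the Euclidean distances in the plane from the points `(x, x)` with
`x ∈ E` to the points `(y, z)` of `E × E` with `y ≠ z`. -/
def boxSet (E : Set ℝ) : Set ℝ :=
  {t : ℝ | ∃ x ∈ E, ∃ y ∈ E, ∃ z ∈ E, y ≠ z ∧ t = Real.sqrt (|y - x| ^ 2 + |z - x| ^ 2)}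

/-- The number in the two definitions is the Euclidean distance of `(y, z)` and `(x, x)`. -/
theorem sqrt_eq_dist_diagonal (x y z : ℝ) :
    Real.sqrt (|y - x| ^ 2 + |z - x| ^ 2) = dist (!₂[y, z]) (!₂[x, x]) := by
  simp [EuclideanSpace.dist_eq, Real.dist_eq]

/-! Squaring removes the root: `(y - x)^2 + (z - x)^2 - 2x^2 = (y^2 + z^2) - 2x(y + z)`. So a pinned
box set is, up to a smooth change of variable, a linear projection of the planar points `(u, v) = (y
+ z, y^2 + z^2)` in a direction given by `x`. With `y` and `z` in two separated pieces of `E`, this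
change of coordinates is bilipschitz, so the planar points carry a measure of dimension `3/2`, while
the directions range over a set of dimension `3/4`. The theorem is then a bound for exceptional
projections, proved by an L² Fourier argument.

Let `μ` be a Frostman measure on `E` of exponent `3/4`
(`exists_measure_le_rpow_of_hausdorffMeasure_ne_zero`). The characteristic function at `t` of the
projected product measure is `oscIntegral F u v 1 x t`. If its square is integrable in `t` and
`μ`-integrable in `x`, then some `x ∈ E` has a square integrable characteristic function, and
`volume_ne_zero_of_lintegral_charFun_sq_ne_top` keeps the projected set from being null.

For `|t|` of size `R = 1/δ` two estimates are combined. When `x` is averaged against a Gaussian, the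
square mean over the band is a double integral of a kernel bounded by a multiple of `δ^2 (δ^2 + U^2
+ V^2)^(-3/2)`, where `U`, `V` are the differences of `u`, `v`. Separation and the Frostman bound in
each coordinate make this `O(R^(-1/2))` (`lintegral_gaussianKernel_le`). Passing from the Gaussian
to `μ` costs `R^(1/4)`, because the oscillatory integral is essentially constant in `x` at scale
`1/R` (`lintegral_norm_oscIntegral_sq_le`). The net bound `R^(-1/4)` is summable over dyadic `R`.
The same count with exponent `s` gives `R^(2-3s)`, so `3/4` is not the borderline of the method. -/

section Frostman

/-! ### Frostman measures on the line, and two separated pieces of positive mass -/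

open Set Filter Topology
open scoped NNReal

/-- The Hausdorff content of dimension `s` on the line. -/
noncomputable def hausdorffContent (s : ℝ) (hs : 0 < s) : OuterMeasure ℝ :=
  OuterMeasure.ofFunction (fun A => Metric.ediam A ^ s) (by simp [hs])

lemma hausdorffContent_le_ediam_rpow {s : ℝ} (hs : 0 < s) (A : Set ℝ) :
    hausdorffContent s hs A ≤ Metric.ediam A ^ s :=
  OuterMeasure.ofFunction_le A

/-- A cover with small total `s`-power has no large piece: if the sum is below `1/(n+1)`, every
diameter is at most `(n+1)^(-1/s)`. Covers that are nearly optimal for the content are therefore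
automatically fine enough for the Hausdorff measure. -/
lemma hausdorffMeasure_eq_zero_of_hausdorffContent_eq_zero {s : ℝ} (hs : 0 < s) {A : Set ℝ}
    (hA : hausdorffContent s hs A = 0) : Measure.hausdorffMeasure s A = 0 := by
  have key : ∀ n : ℕ, ∃ t : ℕ → Set ℝ, A ⊆ ⋃ i, t i ∧
      ∑' i, Metric.ediam (t i) ^ s < ((n : ℝ≥0∞) + 1)⁻¹ := by
    intro n
    have h : hausdorffContent s hs A < ((n : ℝ≥0∞) + 1)⁻¹ := by
      rw [hA]; simp
    rw [hausdorffContent, OuterMeasure.ofFunction_apply] at h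
    simp only [iInf_lt_iff] at h
    obtain ⟨t, h1, h2⟩ := h
    exact ⟨t, h1, h2⟩
  choose t ht hsum using key
  have hlim : Tendsto (fun n : ℕ => ((n : ℝ≥0∞) + 1)⁻¹) atTop (𝓝 0) := by
    have := (tendsto_add_atTop_iff_nat 1).2 ENNReal.tendsto_inv_nat_nhds_zero
    simpa using this
  have hlim' : Tendsto (fun n : ℕ => (((n : ℝ≥0∞) + 1)⁻¹) ^ s⁻¹) atTop (𝓝 0) := by
    have := (ENNReal.continuous_rpow_const (y := s⁻¹)).tendsto 0 |>.comp hlim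
    simpa [hs, Function.comp_def] using this
  have h := Measure.hausdorffMeasure_le_liminf_tsum (l := atTop) s A _ hlim' t
    (Eventually.of_forall fun n i => by
      rw [ENNReal.le_rpow_inv_iff hs]
      exact (ENNReal.le_tsum i).trans (hsum n).le)
    (Eventually.of_forall ht)
  have h2 : liminf (fun n => ∑' i, Metric.ediam (t n i) ^ s) atTop ≤ 0 := by
    rw [← hlim.liminf_eq]
    exact liminf_le_liminf (Eventually.of_forall fun n => (hsum n).le)
  exact le_antisymm (h.trans h2) zero_le

/-- **Frostman's lemma** on the line. -/
theorem exists_measure_le_rpow_of_hausdorffMeasure_ne_zero {s : ℝ} (hs : 0 < s) {E : Set ℝ}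
    (hE : IsCompact E) (hpos : Measure.hausdorffMeasure s E ≠ 0) :
    ∃ μ : Measure ℝ, IsFiniteMeasure μ ∧ μ Eᶜ = 0 ∧ μ ≠ 0 ∧
      ∀ a b : ℝ, a ≤ b → μ (Icc a b) ≤ ENNReal.ofReal ((b - a) ^ s) := by
  set m := hausdorffContent s hs with hm
  have hmE : m E ≠ 0 := fun h =>
    hpos (hausdorffMeasure_eq_zero_of_hausdorffContent_eq_zero hs h)
  obtain ⟨L, hL⟩ := hE.isBounded.subset_closedBall 0
  rw [Real.closedBall_eq_Icc] at hL
  simp only [zero_sub, zero_add] at hL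
  have hfin : ∀ A ⊆ E, m A ≠ ∞ := by
    intro A hA
    refine ne_top_of_le_ne_top ?_ (hausdorffContent_le_ediam_rpow hs A)
    exact ENNReal.rpow_ne_top_of_nonneg hs.le (hE.isBounded.subset hA).ediam_ne_top
  -- In dimension one no weak limit is needed: the distribution function of the content already
  -- defines the measure. Subadditivity of the content bounds its increments by `(y - x)^s`, and its
  -- total increase is the content of `E`, which is positive.
  set f : ℝ → ℝ := fun x => (m (E ∩ Iic x)).toReal with hf
  have hmono : Monotone f := fun x y hxy =>
    ENNReal.toReal_mono (hfin _ inter_subset_left)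
      (measure_mono (inter_subset_inter_right E (Iic_subset_Iic.2 hxy)))
  have hsub : ∀ x y, x ≤ y → f y ≤ f x + (m (E ∩ Ioc x y)).toReal := by
    intro x y hxy
    rw [hf]
    dsimp only
    rw [← ENNReal.toReal_add (hfin _ inter_subset_left) (hfin _ inter_subset_left)]
    refine ENNReal.toReal_mono ?_ ?_
    · exact ENNReal.add_ne_top.2 ⟨hfin _ inter_subset_left, hfin _ inter_subset_left⟩
    · rw [← Iic_union_Ioc_eq_Iic hxy, inter_union_distrib_left]
      exact measure_union_le _ _
  have hIoc : ∀ x y, x ≤ y → (m (E ∩ Ioc x y)).toReal ≤ (y - x) ^ s := by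
    intro x y hxy
    have h1 : m (E ∩ Ioc x y) ≤ ENNReal.ofReal ((y - x) ^ s) := by
      refine (measure_mono inter_subset_right).trans ?_
      refine (hausdorffContent_le_ediam_rpow hs _).trans ?_
      rw [Real.ediam_Ioc, ENNReal.ofReal_rpow_of_nonneg (by linarith) hs.le]
    exact ENNReal.toReal_le_of_le_ofReal (Real.rpow_nonneg (by linarith) _) h1
  have hhol : ∀ x y, x ≤ y → f y - f x ≤ (y - x) ^ s := fun x y hxy => by
    linarith [hsub x y hxy, hIoc x y hxy]
  have hcont : Continuous f := by
    rw [continuous_iff_continuousAt]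
    intro x
    have h1 : Tendsto (fun y => |y - x| ^ s) (𝓝 x) (𝓝 0) := by
      have : ContinuousAt (fun y => |y - x| ^ s) x :=
        ContinuousAt.rpow_const (by fun_prop) (Or.inr hs.le)
      have h2 := this.tendsto
      simpa [hs.ne'] using h2
    rw [ContinuousAt, tendsto_iff_dist_tendsto_zero]
    refine squeeze_zero (fun _ => dist_nonneg) (fun y => ?_) h1
    rw [Real.dist_eq]
    rcases le_total x y with hxy | hxy
    · rw [abs_of_nonneg (sub_nonneg.2 (hmono hxy)), abs_of_nonneg (sub_nonneg.2 hxy)]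
      exact hhol x y hxy
    · rw [abs_sub_comm, abs_of_nonneg (sub_nonneg.2 (hmono hxy)), abs_sub_comm,
        abs_of_nonneg (sub_nonneg.2 hxy)]
      exact hhol y x hxy
  set F : StieltjesFunction ℝ := ⟨f, hmono, fun x => hcont.continuousWithinAt⟩ with hF
  have hFf : ∀ x, F x = f x := fun _ => rfl
  have hbot : ∀ x, x < -L → f x = 0 := by
    intro x hx
    have : E ∩ Iic x = ∅ := by
      ext y
      simp only [mem_inter_iff, mem_Iic, mem_empty_iff_false, iff_false, not_and, not_le]
      intro hy
      linarith [(hL hy).1]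
    simp [hf, this]
  have htop : ∀ x, L ≤ x → f x = (m E).toReal := by
    intro x hx
    have : E ∩ Iic x = E := inter_eq_left.2 fun y hy => (hL hy).2.trans hx
    simp [hf, this]
  have hlimbot : Tendsto F atBot (𝓝 0) :=
    tendsto_const_nhds.congr' <| by
      filter_upwards [eventually_lt_atBot (-L)] with x hx using (hbot x hx).symm
  have hlimtop : Tendsto F atTop (𝓝 (m E).toReal) :=
    tendsto_const_nhds.congr' <| by
      filter_upwards [eventually_ge_atTop L] with x hx using (htop x hx).symm
  have huniv := F.measure_univ hlimbot hlimtop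
  have hleft : ∀ x, Function.leftLim F x = f x := fun x =>
    hcont.continuousAt.continuousWithinAt.leftLim_eq
  refine ⟨F.measure, ⟨by rw [huniv]; exact ENNReal.ofReal_lt_top⟩, ?_, ?_, ?_⟩
  -- The function `f` is constant across every interval that misses `E`, so each point outside `E`
  -- has a null neighbourhood.
  · refine measure_null_of_locally_null _ fun x hx => ?_
    obtain ⟨ε, hε, hball⟩ := Metric.isOpen_iff.1 hE.isClosed.isOpen_compl x hx
    refine ⟨Ioc (x - ε / 2) (x + ε / 2), mem_nhdsWithin_of_mem_nhds
      (Ioc_mem_nhds (by linarith) (by linarith)), ?_⟩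
    rw [F.measure_Ioc, ENNReal.ofReal_eq_zero, hFf, hFf]
    have hempty : E ∩ Ioc (x - ε / 2) (x + ε / 2) = ∅ := by
      ext y
      simp only [mem_inter_iff, mem_Ioc, mem_empty_iff_false, iff_false]
      rintro ⟨hy, h1, h2⟩
      refine hball (?_ : y ∈ Metric.ball x ε) hy
      rw [Metric.mem_ball, Real.dist_eq, abs_lt]
      constructor <;> linarith
    have := hsub (x - ε / 2) (x + ε / 2) (by linarith)
    rw [hempty] at this
    simp at this
    linarith
  · intro h0
    rw [h0] at huniv
    simp only [Measure.coe_zero, Pi.zero_apply, sub_zero] at huniv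
    have h1 := huniv.symm
    rw [ENNReal.ofReal_toReal (hfin E subset_rfl)] at h1
    exact hmE h1
  · intro a b hab
    rw [F.measure_Icc, hleft, hFf]
    exact ENNReal.ofReal_le_ofReal (hhol a b hab)

/-- A nonzero measure on the line without atoms charges two separated intervals. -/
lemma exists_separated_intervals_of_measure_singleton_eq_zero {μ : Measure ℝ} (hμ : μ ≠ 0)
    (hatom : ∀ x, μ {x} = 0) :
    ∃ a b g : ℝ, 0 < g ∧ |b - a| = 3 * g ∧ μ (Icc (a - g) (a + g)) ≠ 0 ∧
      μ (Icc (b - g) (b + g)) ≠ 0 := by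
  obtain ⟨a, -, ha⟩ := exists_mem_forall_mem_nhdsWithin_pos_measure (μ := μ) (s := univ)
    (by simpa using hμ)
  have hc : μ {a}ᶜ ≠ 0 := by
    intro h
    apply hμ
    rw [← Measure.measure_univ_eq_zero, ← union_compl_self {a}]
    exact measure_union_null (hatom a) h
  obtain ⟨b, hb, hb'⟩ := exists_mem_forall_mem_nhdsWithin_pos_measure hc
  have hba : 0 < |b - a| := abs_pos.2 (sub_ne_zero.2 hb)
  -- With radius one third of the distance of the centres, the two intervals are still a distance
  -- `g` apart.
  refine ⟨a, b, |b - a| / 3, by positivity, by ring, ?_, ?_⟩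
  · exact (ha _ (mem_nhdsWithin_of_mem_nhds (Icc_mem_nhds (by linarith) (by linarith)))).ne'
  · exact (hb' _ (mem_nhdsWithin_of_mem_nhds (Icc_mem_nhds (by linarith) (by linarith)))).ne'

end Frostman

/-! ### Square integrable characteristic functions and null sets -/

section FourierL2

open Set Filter Topology
open scoped NNReal FourierTransform ContDiff SchwartzMap

/-- A smooth bump function, as a Schwartz function, that equals `1` on a compact null set and has
small square integral. -/
lemma exists_schwartz_one_on_integral_norm_sq_le {K : Set ℝ} (hK : IsCompact K)
    (h0 : volume K = 0) {ε : ℝ} (hε : 0 < ε) :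
    ∃ f : 𝓢(ℝ, ℂ), (∀ x ∈ K, f x = 1) ∧ ∫ x, ‖f x‖ ^ 2 ≤ ε := by
  obtain ⟨U, hKU, hUo, hU⟩ := K.exists_isOpen_lt_of_lt (μ := volume) (ENNReal.ofReal ε)
    (by rw [h0]; simpa using hε)
  -- Outer regularity gives no bound on the diameter of `U`; the thickening makes the support of the
  -- bump compact.
  have hVo : IsOpen (U ∩ Metric.thickening 1 K) := hUo.inter Metric.isOpen_thickening
  set V := U ∩ Metric.thickening 1 K with hV
  have hKV : K ⊆ V := subset_inter hKU (Metric.self_subset_thickening one_pos K)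
  have hVb : Bornology.IsBounded V := (hK.isBounded.thickening).subset inter_subset_right
  obtain ⟨f, hf0, hf1, hf⟩ := exists_contMDiffMap_zero_one_of_isClosed
    (modelWithCornersSelf ℝ ℝ) (n := (⊤ : ℕ∞)) hVo.isClosed_compl hK.isClosed
    (disjoint_left.2 fun x hx hx' => hx (hKV hx'))
  have hsupp : Function.support (fun x => ((f x : ℝ) : ℂ)) ⊆ V := by
    intro x hx
    by_contra hxV
    exact hx (by simp [hf0 hxV])
  have hcs : HasCompactSupport (fun x => ((f x : ℝ) : ℂ)) :=
    HasCompactSupport.of_support_subset_isCompact hVb.isCompact_closure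
      (hsupp.trans subset_closure)
  have hsmooth : ContDiff ℝ ∞ (fun x => ((f x : ℝ) : ℂ)) :=
    Complex.ofRealCLM.contDiff.comp f.contMDiff.contDiff
  refine ⟨hcs.toSchwartzMap hsmooth, fun x hx => by simp [hf1 hx], ?_⟩
  have hVvol : volume V < ENNReal.ofReal ε := (measure_mono inter_subset_left).trans_lt hU
  calc ∫ x, ‖(hcs.toSchwartzMap hsmooth) x‖ ^ 2 ≤ ∫ x, V.indicator (fun _ => (1 : ℝ)) x := by
        refine integral_mono_of_nonneg (Eventually.of_forall fun x => by positivity) ?_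
          (Eventually.of_forall fun x => ?_)
        · exact (integrable_indicator_iff hVo.measurableSet).2
            (integrableOn_const (hVvol.trans ENNReal.ofReal_lt_top).ne)
        · by_cases hx : x ∈ V
          · have h1 := (hf x).1
            have h2 := (hf x).2
            simp only [HasCompactSupport.toSchwartzMap_toFun, Complex.norm_real, indicator_of_mem hx,
              Real.norm_eq_abs, sq_abs]
            nlinarith
          · simpa [hf0 hx] using indicator_nonneg (fun _ _ => zero_le_one) x
    _ = (volume V).toReal := by
        rw [integral_indicator hVo.measurableSet]
        simp [Measure.real]
    _ ≤ ε := ENNReal.toReal_le_of_le_ofReal hε.le hVvol.le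

/-- A nonzero finite measure with square integrable characteristic function does not live on a
compact null set. -/
theorem volume_ne_zero_of_lintegral_charFun_sq_ne_top {ν : Measure ℝ} [IsFiniteMeasure ν]
    (hν : ν ≠ 0) {K : Set ℝ} (hK : IsCompact K) (hνK : ν Kᶜ = 0)
    (hL2 : ∫⁻ t, ‖charFun ν t‖ₑ ^ 2 ≠ ⊤) : volume K ≠ 0 := by
  intro h0
  have hint : Integrable (fun t => ‖charFun ν t‖ ^ 2) := by
    refine ⟨by fun_prop, ?_⟩
    rw [HasFiniteIntegral]
    simpa using hL2.lt_top
  have hint' : Integrable (fun ξ : ℝ => ‖charFun ν (2 * Real.pi * ξ)‖ ^ 2) :=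
    hint.comp_mul_left' (R := 2 * Real.pi) (by positivity)
  set M := ∫ ξ : ℝ, ‖charFun ν (2 * Real.pi * ξ)‖ ^ 2 with hM
  have hM0 : 0 ≤ M := integral_nonneg fun _ => by positivity
  set m := ν.real univ with hm
  have hm0 : 0 < m := by
    rw [hm, measureReal_def]
    exact ENNReal.toReal_pos (by simpa using hν) (measure_ne_top _ _)
  -- The mass `m` is the `ν`-integral of a bump equal to `1` on `K`, hence a pairing of `charFun ν`
  -- with the Fourier transform of the bump. The weighted inequality `pq ≤ A q^2 + A⁻¹ p^2` replaces
  -- Cauchy–Schwarz, and Plancherel brings in `ε`.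
  have key : ∀ ε > 0, ∀ A > 0, m ≤ A * ε + A⁻¹ * M := by
    intro ε hε A hA
    obtain ⟨f, hf1, hfε⟩ := exists_schwartz_one_on_integral_norm_sq_le hK h0 hε
    have hinv : ∀ a, f a = ∫ ξ : ℝ, Complex.exp (2 * Real.pi * ξ * a * Complex.I) * 𝓕 f ξ := by
      intro a
      have h1 : f a = 𝓕⁻ (𝓕 f) a := by simp
      rw [h1, SchwartzMap.fourierInv_coe, Real.fourierInv_eq']
      congr 1
      ext ξ
      simp only [smul_eq_mul, RCLike.inner_apply, conj_trivial]
      push_cast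
      ring_nf
    have h1 : ((m : ℝ) : ℂ) = ∫ a, f a ∂ν := by
      have : ∫ a, f a ∂ν = ∫ a, (1 : ℂ) ∂ν := by
        refine integral_congr_ae ?_
        filter_upwards [show ∀ᵐ a ∂ν, a ∈ K from hνK] with a ha using hf1 a ha
      rw [this]
      simp [hm]
    have h2 : ∫ a, f a ∂ν = ∫ ξ : ℝ, charFun ν (2 * Real.pi * ξ) * 𝓕 f ξ := by
      simp_rw [hinv]
      rw [integral_integral_swap]
      · congr 1
        ext ξ
        rw [integral_mul_const, charFun_apply_real]
        push_cast
        rfl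
      · have hF : Integrable (fun p : ℝ × ℝ => (1 : ℂ) * 𝓕 f p.2) (ν.prod volume) :=
          Integrable.mul_prod (integrable_const _) (𝓕 f).integrable
        refine hF.mono ?_ (Eventually.of_forall fun p => ?_)
        · refine AEStronglyMeasurable.mul (by fun_prop) ?_
          exact ((𝓕 f).continuous.comp continuous_snd).aestronglyMeasurable
        · simp only [Function.uncurry, norm_mul, one_mul]
          have : ‖Complex.exp (2 * Real.pi * p.2 * p.1 * Complex.I)‖ = 1 := by
            have := Complex.norm_exp_ofReal_mul_I (2 * Real.pi * p.2 * p.1)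
            push_cast at this
            exact this
          rw [this, one_mul]
    have hFint : Integrable (fun ξ => ‖𝓕 f ξ‖ ^ 2) := by
      have := (SchwartzMap.memLp (𝓕 f) 2 volume).integrable_norm_pow (by norm_num)
      simpa using this
    have h3 : ‖((m : ℝ) : ℂ)‖ = m := by
      rw [Complex.norm_real, Real.norm_of_nonneg hm0.le]
    calc m = ‖∫ ξ : ℝ, charFun ν (2 * Real.pi * ξ) * 𝓕 f ξ‖ := by rw [← h2, ← h1, h3]
      _ ≤ ∫ ξ : ℝ, (A * ‖𝓕 f ξ‖ ^ 2 + A⁻¹ * ‖charFun ν (2 * Real.pi * ξ)‖ ^ 2) := by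
          refine norm_integral_le_of_norm_le ((hFint.const_mul _).add (hint'.const_mul _))
            (Eventually.of_forall fun ξ => ?_)
          rw [norm_mul]
          set p := ‖charFun ν (2 * Real.pi * ξ)‖
          set q := ‖𝓕 f ξ‖
          have e : A * q ^ 2 + A⁻¹ * p ^ 2 = A⁻¹ * ((A * q) ^ 2 + p ^ 2) := by
            field_simp
          have e2 : p * q = A⁻¹ * (p * (A * q)) := by field_simp
          rw [e, e2]
          gcongr
          nlinarith [sq_nonneg (A * q - p), sq_nonneg (A * q + p), sq_nonneg (A * q), sq_nonneg p]
      _ = A * (∫ ξ, ‖𝓕 f ξ‖ ^ 2) + A⁻¹ * M := by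
          rw [integral_add (hFint.const_mul _) (hint'.const_mul _), integral_const_mul,
            integral_const_mul]
      _ ≤ A * ε + A⁻¹ * M := by
          rw [SchwartzMap.integral_norm_sq_fourier]
          gcongr
  have hA : 0 < 4 * (M + 1) / m := by positivity
  -- First `A` is taken so large that `A⁻¹ * M ≤ m / 4`, with `M + 1` keeping it positive, then `ε`
  -- so small that `A * ε = m / 4`. This gives `m ≤ m / 2`.
  have := key (m / (4 * (4 * (M + 1) / m))) (by positivity) _ hA
  have e1 : 4 * (M + 1) / m * (m / (4 * (4 * (M + 1) / m))) = m / 4 := by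
    field_simp
  have e2 : (4 * (M + 1) / m)⁻¹ * M ≤ m / 4 := by
    rw [inv_div, div_mul_eq_mul_div, div_le_div_iff₀ (by positivity) (by positivity)]
    nlinarith
  linarith

end FourierL2

/-! ### Differences of Gaussian kernels -/

section GaussianKernel

open Set Filter Topology
open scoped NNReal

/-- The Fourier transform at `v` of `t ↦ exp (- B t ^ 2)`. -/
noncomputable def gaussianKernel (v B : ℝ) : ℝ :=
  Real.sqrt Real.pi * (B ^ (-(1 / 2) : ℝ) * Real.exp (-v ^ 2 / (4 * B)))

lemma hasDerivAt_gaussianKernel (v : ℝ) {B : ℝ} (hB : 0 < B) :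
    HasDerivAt (gaussianKernel v)
      (Real.sqrt Real.pi * B ^ (-(3 / 2) : ℝ) *
        ((v ^ 2 / (4 * B) - 1 / 2) * Real.exp (-(v ^ 2 / (4 * B))))) B := by
  have h1 : HasDerivAt (fun B : ℝ => B ^ (-(1 / 2) : ℝ)) (-(1 / 2) * B ^ (-(1 / 2) - 1 : ℝ)) B :=
    Real.hasDerivAt_rpow_const (Or.inl hB.ne')
  have h2 : HasDerivAt (fun B : ℝ => -v ^ 2 / (4 * B)) (v ^ 2 / (4 * B ^ 2)) B := by
    have := (hasDerivAt_inv hB.ne').const_mul (-v ^ 2 / 4)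
    have e : (fun B : ℝ => -v ^ 2 / (4 * B)) = fun B => -v ^ 2 / 4 * B⁻¹ := by
      ext x; rw [div_mul_eq_div_div, div_eq_mul_inv (-v ^ 2 / 4)]
    rw [e]
    exact this.congr_deriv (by field_simp)
  have h3 := (h1.mul h2.exp).const_mul (Real.sqrt Real.pi)
  refine h3.congr_deriv ?_
  have e1 : B ^ (-(1 / 2) - 1 : ℝ) = B ^ (-(3 / 2) : ℝ) := by norm_num
  have e2 : B ^ (-(1 / 2) : ℝ) = B ^ (-(3 / 2) : ℝ) * B := by
    conv_rhs => rw [← Real.rpow_one B, ← Real.rpow_mul hB.le, one_mul, ← Real.rpow_add hB]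
    norm_num
  rw [e1, e2, neg_div]
  field_simp
  ring

/-- The exponential beats any power. The constant is `12^3`, from cubing `1 + 4X ≤ 12 exp (X/3)`.
With `X = v^2/(4B)` one has `B (1 + 4X) = B + v^2`, which is why `1 + 4X` is the natural quantity.
-/
lemma abs_sub_half_mul_exp_neg_le {X : ℝ} (hX : 0 ≤ X) :
    |(X - 1 / 2) * Real.exp (-X)| ≤ 1728 * (1 + 4 * X) ^ (-(3 / 2) : ℝ) := by
  have h1 : |X - 1 / 2| ≤ 1 + 4 * X := by
    rw [abs_le]; constructor <;> linarith
  have hY : (1 : ℝ) ≤ 1 + 4 * X := by linarith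
  have h2 : (1 + 4 * X) ^ 3 ≤ 1728 * Real.exp X := by
    have h : 1 + 4 * X ≤ 12 * Real.exp (X / 3) := by
      linarith [Real.add_one_le_exp (X / 3)]
    calc (1 + 4 * X) ^ 3 ≤ (12 * Real.exp (X / 3)) ^ 3 := by gcongr
      _ = 1728 * Real.exp X := by
        rw [mul_pow, ← Real.exp_nat_mul]
        norm_num
        ring_nf
  have h3 : 1 + 4 * X ≤ (1 + 4 * X) ^ 3 * (1 + 4 * X) ^ (-(3 / 2) : ℝ) := by
    rw [← Real.rpow_natCast, ← Real.rpow_add (by linarith)]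
    conv_lhs => rw [← Real.rpow_one (1 + 4 * X)]
    exact Real.rpow_le_rpow_of_exponent_le hY (by norm_num)
  have hp : 0 ≤ (1 + 4 * X) ^ (-(3 / 2) : ℝ) := by positivity
  rw [abs_mul, abs_of_pos (Real.exp_pos _), Real.exp_neg, ← div_eq_mul_inv,
    div_le_iff₀ (Real.exp_pos _)]
  calc |X - 1 / 2| ≤ (1 + 4 * X) ^ 3 * (1 + 4 * X) ^ (-(3 / 2) : ℝ) := h1.trans h3
    _ ≤ 1728 * Real.exp X * (1 + 4 * X) ^ (-(3 / 2) : ℝ) := by gcongr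
    _ = _ := by ring

lemma abs_deriv_gaussianKernel_le (v : ℝ) {B : ℝ} (hB : 0 < B) :
    |Real.sqrt Real.pi * B ^ (-(3 / 2) : ℝ) *
        ((v ^ 2 / (4 * B) - 1 / 2) * Real.exp (-(v ^ 2 / (4 * B))))| ≤
      1728 * Real.sqrt Real.pi * (B + v ^ 2) ^ (-(3 / 2) : ℝ) := by
  have hX : 0 ≤ v ^ 2 / (4 * B) := by positivity
  have e : B + v ^ 2 = B * (1 + 4 * (v ^ 2 / (4 * B))) := by field_simp
  rw [e, Real.mul_rpow hB.le (by positivity), abs_mul, abs_of_nonneg (by positivity)]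
  calc _ ≤ Real.sqrt Real.pi * B ^ (-(3 / 2) : ℝ) *
        (1728 * (1 + 4 * (v ^ 2 / (4 * B))) ^ (-(3 / 2) : ℝ)) := by
        gcongr
        exact abs_sub_half_mul_exp_neg_le hX
    _ = _ := by ring

/-- Mean value inequality in `B`. A single kernel decays only like the inverse of the distance; the
difference gains the factor `d`, later `δ^2`, and two more powers of decay. This cancellation
produces the decay in frequency. -/
lemma abs_gaussianKernel_sub_le (v : ℝ) {B d : ℝ} (hB : 0 < B) (hd : 0 ≤ d) :
    |gaussianKernel v B - gaussianKernel v (B + d)| ≤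
      1728 * Real.sqrt Real.pi * (B + v ^ 2) ^ (-(3 / 2) : ℝ) * d := by
  have := (convex_Ici B).norm_image_sub_le_of_norm_hasDerivWithin_le
    (f := gaussianKernel v) (C := 1728 * Real.sqrt Real.pi * (B + v ^ 2) ^ (-(3 / 2) : ℝ))
    (fun x hx => (hasDerivAt_gaussianKernel v (hB.trans_le hx)).hasDerivWithinAt)
    (fun x (hx : B ≤ x) => by
      refine (abs_deriv_gaussianKernel_le v (hB.trans_le hx)).trans ?_
      gcongr ?_ * ?_
      exact Real.rpow_le_rpow_of_nonpos (by positivity) (by linarith) (by norm_num))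
    (show B + d ∈ Ici B by simpa using hd) (self_mem_Ici (a := B))
  rwa [Real.norm_eq_abs, Real.norm_eq_abs, sub_add_cancel_left, abs_neg, abs_of_nonneg hd] at this

end GaussianKernel

/-! ### Energy estimates and separation from the diagonal -/

section Energy

open Set Filter Topology
open scoped NNReal

lemma summable_one_add_sq_rpow :
    Summable fun k : ℕ => (1 + (k : ℝ) ^ 2) ^ (-(3 / 4) : ℝ) := by
  have h : Summable fun k : ℕ => (((k + 1 : ℕ) : ℝ)) ^ (-(3 / 2) : ℝ) :=
    (summable_nat_add_iff 1).2 (Real.summable_nat_rpow.2 (by norm_num))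
  refine Summable.of_nonneg_of_le (fun k => by positivity) (fun k => ?_)
    (h.mul_left ((1 / 2 : ℝ) ^ (-(3 / 4) : ℝ)))
  have e : (((k + 1 : ℕ) : ℝ)) ^ (-(3 / 2) : ℝ) = ((k + 1 : ℝ) ^ 2) ^ (-(3 / 4) : ℝ) := by
    rw [← Real.rpow_natCast, ← Real.rpow_mul (by positivity)]
    push_cast
    norm_num
  rw [e, ← Real.mul_rpow (by positivity) (by positivity)]
  exact Real.rpow_le_rpow_of_nonpos (by positivity) (by nlinarith [sq_nonneg ((k : ℝ) - 1)])
    (by norm_num)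

/-- The line is cut into shells `kδ ≤ |y - y'| ≤ (k+1)δ`. Each is covered by two intervals of length
`δ`, so has mass at most `2δ^(3/4)`, and the kernel there is at most `δ^(-3/2) (1 + k^2)^(-3/4)`,
which is summable in `k`. -/
lemma exists_lintegral_rpow_le {μ : Measure ℝ}
    (hμ : ∀ a b : ℝ, a ≤ b → μ (Icc a b) ≤ ENNReal.ofReal ((b - a) ^ (3 / 4 : ℝ))) :
    ∃ C : ℝ≥0∞, C ≠ ⊤ ∧ ∀ δ : ℝ, 0 < δ → ∀ y : ℝ,
      ∫⁻ y', ENNReal.ofReal ((δ ^ 2 + (y - y') ^ 2) ^ (-(3 / 4) : ℝ)) ∂μ ≤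
        C * ENNReal.ofReal (δ ^ (-(3 / 4) : ℝ)) := by
  refine ⟨(∑' k : ℕ, ENNReal.ofReal ((1 + (k : ℝ) ^ 2) ^ (-(3 / 4) : ℝ))) * 2,
    ENNReal.mul_ne_top summable_one_add_sq_rpow.tsum_ofReal_ne_top (by simp), fun δ hδ y => ?_⟩
  set A : ℕ → Set ℝ := fun k =>
    {y' | k * δ ≤ |y - y'| ∧ |y - y'| ≤ (k + 1) * δ} with hA
  have hAm : ∀ k, MeasurableSet (A k) := fun k => by
    have h1 : MeasurableSet {y' : ℝ | k * δ ≤ |y - y'|} :=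
      measurableSet_le (by fun_prop) (by fun_prop)
    have h2 : MeasurableSet {y' : ℝ | |y - y'| ≤ (k + 1) * δ} :=
      measurableSet_le (by fun_prop) (by fun_prop)
    exact h1.inter h2
  have hcover : (⋃ k, A k) = univ := by
    refine eq_univ_of_forall fun y' => mem_iUnion.2 ⟨⌊|y - y'| / δ⌋₊, ?_, ?_⟩
    · exact (le_div_iff₀ hδ).1 (Nat.floor_le (by positivity))
    · exact (div_le_iff₀ hδ).1 (Nat.lt_floor_add_one _).le
  have hAμ : ∀ k, μ (A k) ≤ 2 * ENNReal.ofReal (δ ^ (3 / 4 : ℝ)) := by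
    intro k
    have hsub : A k ⊆ Icc (y - (k + 1) * δ) (y - k * δ) ∪ Icc (y + k * δ) (y + (k + 1) * δ) := by
      rintro y' ⟨h1, h2⟩
      rcases le_total 0 (y - y') with h | h
      · rw [abs_of_nonneg h] at h1 h2
        exact Or.inl ⟨by linarith, by linarith⟩
      · rw [abs_of_nonpos h] at h1 h2
        exact Or.inr ⟨by linarith, by linarith⟩
    refine (measure_mono hsub).trans ((measure_union_le _ _).trans ?_)
    rw [two_mul]
    gcongr
    · refine (hμ _ _ (by linarith)).trans_eq ?_
      congr 2; ring
    · refine (hμ _ _ (by linarith)).trans_eq ?_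
      congr 2; ring
  calc ∫⁻ y', ENNReal.ofReal ((δ ^ 2 + (y - y') ^ 2) ^ (-(3 / 4) : ℝ)) ∂μ
      = ∫⁻ y' in ⋃ k, A k, ENNReal.ofReal ((δ ^ 2 + (y - y') ^ 2) ^ (-(3 / 4) : ℝ)) ∂μ := by
        rw [hcover, Measure.restrict_univ]
    _ ≤ ∑' k, ∫⁻ y' in A k, ENNReal.ofReal ((δ ^ 2 + (y - y') ^ 2) ^ (-(3 / 4) : ℝ)) ∂μ :=
        lintegral_iUnion_le _ _
    _ ≤ ∑' k : ℕ, ENNReal.ofReal ((1 + (k : ℝ) ^ 2) ^ (-(3 / 4) : ℝ)) *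
          (2 * ENNReal.ofReal (δ ^ (-(3 / 4) : ℝ))) := by
        refine ENNReal.tsum_le_tsum fun k => ?_
        calc ∫⁻ y' in A k, ENNReal.ofReal ((δ ^ 2 + (y - y') ^ 2) ^ (-(3 / 4) : ℝ)) ∂μ
            ≤ ∫⁻ y' in A k, ENNReal.ofReal
                ((1 + (k : ℝ) ^ 2) ^ (-(3 / 4) : ℝ) * δ ^ (-(3 / 2) : ℝ)) ∂μ := by
              refine setLIntegral_mono (by fun_prop) fun y' hy' => ENNReal.ofReal_le_ofReal ?_
              have e : δ ^ (-(3 / 2) : ℝ) = (δ ^ 2) ^ (-(3 / 4) : ℝ) := by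
                rw [← Real.rpow_natCast, ← Real.rpow_mul hδ.le]
                norm_num
              rw [e, ← Real.mul_rpow (by positivity) (by positivity)]
              refine Real.rpow_le_rpow_of_nonpos (by positivity) ?_ (by norm_num)
              have : (k * δ) ^ 2 ≤ (y - y') ^ 2 := by
                rw [← sq_abs (y - y')]
                exact pow_le_pow_left₀ (by positivity) hy'.1 2
              linarith [mul_pow (k : ℝ) δ 2]
          _ = ENNReal.ofReal ((1 + (k : ℝ) ^ 2) ^ (-(3 / 4) : ℝ) * δ ^ (-(3 / 2) : ℝ)) *
                μ (A k) := by simp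
          _ ≤ ENNReal.ofReal ((1 + (k : ℝ) ^ 2) ^ (-(3 / 4) : ℝ) * δ ^ (-(3 / 2) : ℝ)) *
                (2 * ENNReal.ofReal (δ ^ (3 / 4 : ℝ))) := by gcongr; exact hAμ k
          _ = _ := by
              have e : δ ^ (-(3 / 4) : ℝ) = δ ^ (-(3 / 2) : ℝ) * δ ^ (3 / 4 : ℝ) := by
                rw [← Real.rpow_add hδ]; norm_num
              rw [e, ENNReal.ofReal_mul (by positivity), ENNReal.ofReal_mul (by positivity)]
              ring
    _ = _ := by
        rw [ENNReal.tsum_mul_right]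
        ring

lemma sub_sq_add_add_sq (x y : ℝ) : (x - y) ^ 2 + (x + y) ^ 2 = 2 * x ^ 2 + 2 * y ^ 2 := by ring

/-- The map `(y, z) ↦ (y + z, y ^ 2 + z ^ 2)` is bilipschitz away from the diagonal. -/
lemma sq_add_sq_le_of_separated {a b g y z y' z' : ℝ} (hg : 0 < g) (hab : |b - a| = 3 * g)
    (hy : y ∈ Icc (a - g) (a + g)) (hy' : y' ∈ Icc (a - g) (a + g))
    (hz : z ∈ Icc (b - g) (b + g)) (hz' : z' ∈ Icc (b - g) (b + g)) :
    (y - y') ^ 2 + (z - z') ^ 2 ≤ (4 + 16 * (|a| + |b| + g) ^ 2) / (4 * g ^ 2) *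
      (((y + z) - (y' + z')) ^ 2 + ((y ^ 2 + z ^ 2) - (y' ^ 2 + z' ^ 2)) ^ 2) := by
  set N := |a| + |b| + g with hN
  set U := (y + z) - (y' + z') with hU
  set V := (y ^ 2 + z ^ 2) - (y' ^ 2 + z' ^ 2) with hV
  obtain ⟨hy1, hy2⟩ := hy
  obtain ⟨hy1', hy2'⟩ := hy'
  obtain ⟨hz1, hz2⟩ := hz
  obtain ⟨hz1', hz2'⟩ := hz'
  -- Both `z - y` and `z' - y'` have size at least `3g - 2g = g` and the same sign, so their sum has
  -- size at least `2g`.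
  have hgap : 4 * g ^ 2 ≤ (z + z' - y - y') ^ 2 := by
    rcases abs_cases (b - a) with ⟨h, -⟩ | ⟨h, -⟩
    · nlinarith
    · nlinarith
  have hyN : (y + y') ^ 2 ≤ 4 * N ^ 2 := by
    have h : |y + y'| ≤ 2 * N := by
      rw [abs_le]
      constructor <;> linarith [neg_abs_le a, le_abs_self a, abs_nonneg b]
    calc (y + y') ^ 2 = |y + y'| ^ 2 := (sq_abs _).symm
      _ ≤ (2 * N) ^ 2 := by gcongr
      _ = 4 * N ^ 2 := by ring
  have hzN : (z + z') ^ 2 ≤ 4 * N ^ 2 := by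
    have h : |z + z'| ≤ 2 * N := by
      rw [abs_le]
      constructor <;> linarith [neg_abs_le b, le_abs_self b, abs_nonneg a]
    calc (z + z') ^ 2 = |z + z'| ^ 2 := (sq_abs _).symm
      _ ≤ (2 * N) ^ 2 := by gcongr
      _ = 4 * N ^ 2 := by ring
  -- The relations `U = (y - y') + (z - z')` and `V = (y + y')(y - y') + (z + z')(z - z')` form a
  -- linear system for the two differences; this is Cramer's rule, with the determinant bounded
  -- below by `hgap`.
  have e1 : (z - z') * (z + z' - y - y') = V - (y + y') * U := by rw [hU, hV]; ring
  have e2 : (y - y') * (z + z' - y - y') = (z + z') * U - V := by rw [hU, hV]; ring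
  have b1 : (z - z') ^ 2 * (4 * g ^ 2) ≤ 2 * V ^ 2 + 8 * N ^ 2 * U ^ 2 := by
    calc (z - z') ^ 2 * (4 * g ^ 2) ≤ (z - z') ^ 2 * (z + z' - y - y') ^ 2 := by gcongr
      _ = (V - (y + y') * U) ^ 2 := by rw [← mul_pow, e1]
      _ ≤ 2 * V ^ 2 + 2 * ((y + y') ^ 2 * U ^ 2) := by
        rw [← mul_pow]; linarith [sub_sq_add_add_sq V ((y + y') * U), sq_nonneg (V + (y + y') * U)]
      _ ≤ 2 * V ^ 2 + 2 * ((4 * N ^ 2) * U ^ 2) := by gcongr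
      _ = _ := by ring
  have b2 : (y - y') ^ 2 * (4 * g ^ 2) ≤ 2 * V ^ 2 + 8 * N ^ 2 * U ^ 2 := by
    calc (y - y') ^ 2 * (4 * g ^ 2) ≤ (y - y') ^ 2 * (z + z' - y - y') ^ 2 := by gcongr
      _ = ((z + z') * U - V) ^ 2 := by rw [← mul_pow, e2]
      _ ≤ 2 * V ^ 2 + 2 * ((z + z') ^ 2 * U ^ 2) := by
        rw [← mul_pow]; linarith [sub_sq_add_add_sq ((z + z') * U) V, sq_nonneg ((z + z') * U + V)]
      _ ≤ 2 * V ^ 2 + 2 * ((4 * N ^ 2) * U ^ 2) := by gcongr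
      _ = _ := by ring
  clear_value N U V
  rw [div_mul_eq_mul_div, le_div_iff₀ (by positivity)]
  have e : (4 + 16 * N ^ 2) * (U ^ 2 + V ^ 2) =
      4 * V ^ 2 + 16 * N ^ 2 * U ^ 2 + (4 * U ^ 2 + 16 * (N ^ 2 * V ^ 2)) := by ring
  have e0 : 0 ≤ 4 * U ^ 2 + 16 * (N ^ 2 * V ^ 2) := by positivity
  linarith

/-- Splitting the exponent `3/2` evenly decouples the two coordinates, so that the Frostman bound
can be used in each. The constant `K + 1` also absorbs `d` when `K < 1`. -/
lemma rpow_neg_three_halves_le_mul {K d p q W : ℝ} (hK : 0 ≤ K) (hd : 0 < d)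
    (hpq : p ^ 2 + q ^ 2 ≤ K * W) (hW : 0 ≤ W) :
    (d + W) ^ (-(3 / 2) : ℝ) ≤ (K + 1) ^ (3 / 2 : ℝ) *
      ((d + p ^ 2) ^ (-(3 / 4) : ℝ) * (d + q ^ 2) ^ (-(3 / 4) : ℝ)) := by
  have h1 : (d + p ^ 2 + q ^ 2) / (K + 1) ≤ d + W := by
    rw [div_le_iff₀ (by positivity)]
    nlinarith [mul_nonneg hK hd.le]
  have hpos : 0 < d + p ^ 2 + q ^ 2 := by positivity
  calc (d + W) ^ (-(3 / 2) : ℝ) ≤ ((d + p ^ 2 + q ^ 2) / (K + 1)) ^ (-(3 / 2) : ℝ) :=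
        Real.rpow_le_rpow_of_nonpos (by positivity) h1 (by norm_num)
    _ = (K + 1) ^ (3 / 2 : ℝ) *
          ((d + p ^ 2 + q ^ 2) ^ (-(3 / 4) : ℝ) * (d + p ^ 2 + q ^ 2) ^ (-(3 / 4) : ℝ)) := by
        rw [← Real.rpow_add hpos, Real.div_rpow hpos.le (by positivity),
          Real.rpow_neg (by positivity : 0 ≤ K + 1), div_inv_eq_mul, mul_comm]
        norm_num
    _ ≤ _ := by
        gcongr (K + 1) ^ (3 / 2 : ℝ) * (?_ * ?_)
        · exact Real.rpow_le_rpow_of_nonpos (by positivity) (by linarith [sq_nonneg q])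
            (by norm_num)
        · exact Real.rpow_le_rpow_of_nonpos (by positivity) (by linarith [sq_nonneg p])
            (by norm_num)

end Energy

/-! ### Oscillatory integrals and their Gaussian-averaged square means -/

section Oscillatory

open Set Filter Topology
open scoped NNReal ComplexConjugate

lemma integral_cexp_neg_mul_sq_add_mul_I {B : ℝ} (hB : 0 < B) (v : ℝ) :
    ∫ t : ℝ, Complex.exp (-(B : ℂ) * (t : ℂ) ^ 2 + (v * Complex.I) * t + 0) =
      (gaussianKernel v B : ℂ) := by
  rw [integral_cexp_quadratic (by simpa using hB), gaussianKernel, neg_neg, zero_sub]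
  push_cast
  rw [Real.sqrt_eq_rpow, ← Complex.ofReal_div, ← mul_assoc]
  have e1 : (((Real.pi / B : ℝ) : ℂ)) ^ (1 / 2 : ℂ) = ((Real.pi / B) ^ (1 / 2 : ℝ) : ℝ) := by
    rw [Complex.ofReal_cpow (by positivity)]
    push_cast; rfl
  rw [e1, Real.div_rpow Real.pi_nonneg hB.le, Real.rpow_neg hB.le, div_eq_mul_inv]
  push_cast
  congr 2
  have : (B : ℂ) ≠ 0 := by exact_mod_cast hB.ne'
  rw [mul_pow, Complex.I_sq]
  field_simp

/-- A difference of Gaussians, comparable to `1` for `t` of size `1 / δ`. -/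
noncomputable def gaussianBand (δ t : ℝ) : ℝ :=
  Real.exp (-δ ^ 2 * t ^ 2) - Real.exp (-(2 * δ ^ 2) * t ^ 2)

lemma gaussianBand_nonneg (δ t : ℝ) : 0 ≤ gaussianBand δ t := by
  rw [gaussianBand, sub_nonneg, Real.exp_le_exp]
  nlinarith [mul_nonneg (sq_nonneg δ) (sq_nonneg t)]

@[fun_prop]
lemma continuous_gaussianBand (δ : ℝ) : Continuous (gaussianBand δ) := by
  unfold gaussianBand
  fun_prop

lemma integrable_gaussianBand {δ : ℝ} (hδ : 0 < δ) : Integrable (gaussianBand δ) :=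
  (integrable_exp_neg_mul_sq (by positivity)).sub (integrable_exp_neg_mul_sq (by positivity))

lemma integrable_gaussianBand_mul_exp {δ : ℝ} (hδ : 0 < δ) :
    Integrable (fun s : ℝ × ℝ => gaussianBand δ s.1 * Real.exp (-s.2 ^ 2))
      (volume.prod volume) := by
  refine (integrable_gaussianBand hδ).mul_prod (g := fun y => Real.exp (-y ^ 2)) ?_
  simpa using integrable_exp_neg_mul_sq one_pos

/-- Integrating the pin variable first gives `√π exp (-t^2 u^2)`, which adds `u^2` to the Gaussian
exponents `δ^2` and `2δ^2` of the band. The integral over `t` is then a difference of two Gaussian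
Fourier transforms. -/
lemma integral_gaussianBand_mul_exp_mul_cexp {δ : ℝ} (hδ : 0 < δ) (u v : ℝ) :
    ∫ s : ℝ × ℝ, ((gaussianBand δ s.1 * Real.exp (-s.2 ^ 2) : ℝ) : ℂ) *
        Complex.exp ((s.1 * (v - 2 * s.2 * u) : ℝ) * Complex.I) ∂(volume.prod volume) =
      ((Real.sqrt Real.pi * (gaussianKernel v (δ ^ 2 + u ^ 2) -
        gaussianKernel v (δ ^ 2 + u ^ 2 + δ ^ 2)) : ℝ) : ℂ) := by
  rw [integral_prod]
  · have h1 : ∀ t : ℝ, ∫ y : ℝ, ((gaussianBand δ t * Real.exp (-y ^ 2) : ℝ) : ℂ) *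
        Complex.exp ((t * (v - 2 * y * u) : ℝ) * Complex.I) =
        (Real.sqrt Real.pi : ℂ) *
          (Complex.exp (-((δ ^ 2 + u ^ 2 : ℝ) : ℂ) * (t : ℂ) ^ 2 + (v * Complex.I) * t + 0) -
          Complex.exp (-((δ ^ 2 + u ^ 2 + δ ^ 2 : ℝ) : ℂ) * (t : ℂ) ^ 2 +
            (v * Complex.I) * t + 0)) := by
      intro t
      have e : ∀ y : ℝ, ((gaussianBand δ t * Real.exp (-y ^ 2) : ℝ) : ℂ) *
          Complex.exp ((t * (v - 2 * y * u) : ℝ) * Complex.I) =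
          (gaussianBand δ t : ℂ) * Complex.exp (-1 * (y : ℂ) ^ 2 +
            (-2 * t * u * Complex.I) * y + t * v * Complex.I) := by
        intro y
        push_cast
        rw [mul_assoc, ← Complex.exp_add]
        congr 2
        ring
      simp_rw [e]
      rw [integral_const_mul, integral_cexp_quadratic (by simp)]
      have e2 : ((Real.pi : ℂ) / - -1) ^ (1 / 2 : ℂ) = (Real.sqrt Real.pi : ℂ) := by
        rw [Real.sqrt_eq_rpow, Complex.ofReal_cpow Real.pi_nonneg]
        push_cast
        norm_num
      rw [e2, gaussianBand]
      push_cast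
      rw [mul_left_comm, sub_mul, ← Complex.exp_add, ← Complex.exp_add]
      congr 2
      · congr 1
        linear_combination (t : ℂ) ^ 2 * u ^ 2 * Complex.I_sq
      · congr 1
        linear_combination (t : ℂ) ^ 2 * u ^ 2 * Complex.I_sq
    simp_rw [h1]
    rw [integral_const_mul, integral_sub, integral_cexp_neg_mul_sq_add_mul_I (by positivity),
      integral_cexp_neg_mul_sq_add_mul_I (by positivity)]
    · push_cast; ring
    · exact integrable_cexp_quadratic' (by
        rw [Complex.neg_re, Complex.ofReal_re, neg_lt_zero]; positivity) _ _
    · exact integrable_cexp_quadratic' (by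
        rw [Complex.neg_re, Complex.ofReal_re, neg_lt_zero]; positivity) _ _
  · refine (integrable_gaussianBand_mul_exp hδ).mono (by fun_prop)
      (Eventually.of_forall fun s => ?_)
    rw [norm_mul, Complex.norm_exp_ofReal_mul_I, mul_one, Complex.norm_real]

lemma norm_oscIntegrand {α : Type*} (u v a : α → ℝ) (x t : ℝ) (p : α) :
    ‖(a p : ℂ) * Complex.exp ((t * (v p - 2 * x * u p) : ℝ) * Complex.I)‖ = ‖a p‖ := by
  rw [norm_mul, Complex.norm_exp_ofReal_mul_I, mul_one, Complex.norm_real]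

variable {α : Type*} [MeasurableSpace α]

/-- The oscillatory integral at frequency `t` with amplitude `a` and phase `v - 2 x u`. -/
noncomputable def oscIntegral (F : Measure α) (u v a : α → ℝ) (x t : ℝ) : ℂ :=
  ∫ p, (a p : ℂ) * Complex.exp ((t * (v p - 2 * x * u p) : ℝ) * Complex.I) ∂F

lemma integrable_oscIntegrand {F : Measure α} {u v a : α → ℝ} (hu : Measurable u)
    (hv : Measurable v) (ha : Integrable a F) (x t : ℝ) :
    Integrable (fun p => (a p : ℂ) *
      Complex.exp ((t * (v p - 2 * x * u p) : ℝ) * Complex.I)) F := by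
  refine ha.mono ?_ (Eventually.of_forall fun p => (norm_oscIntegrand u v a x t p).le)
  refine AEStronglyMeasurable.mul ?_ (by fun_prop)
  exact Complex.continuous_ofReal.comp_aestronglyMeasurable ha.1

lemma continuous_oscIntegral {F : Measure α} {u v a : α → ℝ} (hu : Measurable u)
    (hv : Measurable v) (ha : Integrable a F) :
    Continuous fun s : ℝ × ℝ => oscIntegral F u v a s.2 s.1 := by
  refine continuous_of_dominated (bound := fun p => ‖a p‖)
    (fun s => (integrable_oscIntegrand hu hv ha _ _).1)
    (fun s => Eventually.of_forall fun p => (norm_oscIntegrand u v a _ _ p).le) ha.norm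
    (Eventually.of_forall fun p => by fun_prop)

lemma norm_oscIntegral_sq {F : Measure α} [SFinite F] {u v a : α → ℝ} (x t : ℝ) :
    ((‖oscIntegral F u v a x t‖ ^ 2 : ℝ) : ℂ) = ∫ r : α × α, ((a r.1 * a r.2 : ℝ) : ℂ) *
      Complex.exp ((t * ((v r.1 - v r.2) - 2 * x * (u r.1 - u r.2)) : ℝ) * Complex.I)
        ∂(F.prod F) := by
  push_cast
  rw [← Complex.mul_conj']
  unfold oscIntegral
  rw [← integral_conj, ← integral_prod_mul]
  congr 1
  ext r
  rw [map_mul, Complex.conj_ofReal, ← Complex.exp_conj, map_mul, Complex.conj_ofReal,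
    Complex.conj_I, mul_mul_mul_comm, ← Complex.exp_add]
  push_cast
  congr 2
  ring

/-- The square mean of an oscillatory integral over a frequency band and over the parameter,
as an energy of the measure. -/
lemma integral_gaussianBand_norm_oscIntegral_sq {F : Measure α} [IsFiniteMeasure F]
    {u v a : α → ℝ} (hu : Measurable u) (hv : Measurable v) (ha : Integrable a F) {δ : ℝ}
    (hδ : 0 < δ) :
    ∫ s : ℝ × ℝ, (gaussianBand δ s.1 * Real.exp (-s.2 ^ 2)) *
        ‖oscIntegral F u v a s.2 s.1‖ ^ 2 ∂(volume.prod volume) =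
      Real.sqrt Real.pi * ∫ r : α × α, (a r.1 * a r.2) *
        (gaussianKernel (v r.1 - v r.2) (δ ^ 2 + (u r.1 - u r.2) ^ 2) -
          gaussianKernel (v r.1 - v r.2) (δ ^ 2 + (u r.1 - u r.2) ^ 2 + δ ^ 2)) ∂(F.prod F) := by
  apply Complex.ofReal_injective
  rw [← integral_complex_ofReal, Complex.ofReal_mul, ← integral_complex_ofReal,
    ← integral_const_mul]
  have h1 : ∀ s : ℝ × ℝ, (((gaussianBand δ s.1 * Real.exp (-s.2 ^ 2)) *
      ‖oscIntegral F u v a s.2 s.1‖ ^ 2 : ℝ) : ℂ) = ∫ r : α × α,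
        ((gaussianBand δ s.1 * Real.exp (-s.2 ^ 2) : ℝ) : ℂ) * (((a r.1 * a r.2 : ℝ) : ℂ) *
        Complex.exp ((s.1 * ((v r.1 - v r.2) - 2 * s.2 * (u r.1 - u r.2)) : ℝ) * Complex.I))
          ∂(F.prod F) := by
    intro s
    rw [Complex.ofReal_mul, norm_oscIntegral_sq, integral_const_mul]
  simp_rw [h1]
  rw [integral_integral_swap]
  · congr 1
    ext r
    have e : ∀ s : ℝ × ℝ, ((gaussianBand δ s.1 * Real.exp (-s.2 ^ 2) : ℝ) : ℂ) *
        (((a r.1 * a r.2 : ℝ) : ℂ) * Complex.exp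
          ((s.1 * ((v r.1 - v r.2) - 2 * s.2 * (u r.1 - u r.2)) : ℝ) * Complex.I)) =
        ((a r.1 * a r.2 : ℝ) : ℂ) * (((gaussianBand δ s.1 * Real.exp (-s.2 ^ 2) : ℝ) : ℂ) *
          Complex.exp
          ((s.1 * ((v r.1 - v r.2) - 2 * s.2 * (u r.1 - u r.2)) : ℝ) * Complex.I)) :=
      fun s => mul_left_comm _ _ _
    simp_rw [e]
    rw [integral_const_mul, integral_gaussianBand_mul_exp_mul_cexp hδ]
    push_cast
    ring
  · have hw := integrable_gaussianBand_mul_exp hδ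
    have hprod := hw.mul_prod (ha.mul_prod ha)
    refine hprod.mono ?_ (Eventually.of_forall fun q => ?_)
    · refine AEStronglyMeasurable.mul (f := fun q : (ℝ × ℝ) × (α × α) =>
        ((gaussianBand δ q.1.1 * Real.exp (-q.1.2 ^ 2) : ℝ) : ℂ)) (by fun_prop) ?_
      refine AEStronglyMeasurable.mul (f := fun q : (ℝ × ℝ) × (α × α) =>
        ((a q.2.1 * a q.2.2 : ℝ) : ℂ)) ?_ ?_
      · exact Complex.continuous_ofReal.comp_aestronglyMeasurable (ha.mul_prod ha).1.comp_snd
      · have : Measurable fun q : (ℝ × ℝ) × (α × α) =>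
          Complex.exp ((q.1.1 * ((v q.2.1 - v q.2.2) - 2 * q.1.2 * (u q.2.1 - u q.2.2)) : ℝ) *
            Complex.I) := by fun_prop
        exact this.aestronglyMeasurable
    · simp only [Function.uncurry]
      rw [norm_mul, norm_mul, Complex.norm_exp_ofReal_mul_I, mul_one, Complex.norm_real,
        Complex.norm_real]
      simp only [norm_mul, le_refl]

/-- Differentiating in the pin gives a factor `t` and the amplitude `2u`; this is the reason for
allowing amplitudes other than `1`. -/
lemma hasDerivAt_oscIntegral {F : Measure α} [IsFiniteMeasure F] {u v : α → ℝ}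
    (hu : Measurable u) (hv : Measurable v) (hui : Integrable u F) (x t : ℝ) :
    HasDerivAt (fun x => oscIntegral F u v 1 x t)
      (-(t : ℂ) * Complex.I * oscIntegral F u v (fun p => 2 * u p) x t) x := by
  have h1 : Integrable (1 : α → ℝ) F := integrable_const _
  have h2 : Integrable (fun p => 2 * u p) F := hui.const_mul 2
  have hmain := hasDerivAt_integral_of_dominated_loc_of_deriv_le (μ := F) (x₀ := x)
    (s := univ) (bound := fun p => |t| * ‖2 * u p‖)
    (F := fun x p => (((1 : α → ℝ) p : ℝ) : ℂ) *
      Complex.exp ((t * (v p - 2 * x * u p) : ℝ) * Complex.I))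
    (F' := fun x p => (-(t : ℂ) * Complex.I) * (((2 * u p : ℝ) : ℂ) *
      Complex.exp ((t * (v p - 2 * x * u p) : ℝ) * Complex.I)))
    univ_mem
    (Eventually.of_forall fun y => (integrable_oscIntegrand hu hv h1 y t).1)
    (integrable_oscIntegrand hu hv h1 x t)
    ((integrable_oscIntegrand hu hv h2 x t).1.const_mul _)
    (Eventually.of_forall fun p y _ => by
      rw [norm_mul, norm_oscIntegrand u v (fun p => 2 * u p)]
      simp)
    (h2.norm.const_mul _)
    (Eventually.of_forall fun p y _ => by
      have hd : HasDerivAt (fun x : ℝ => t * (v p - 2 * x * u p)) (t * (-(2 * u p))) y := by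
        have := ((((hasDerivAt_id y).const_mul 2).mul_const (u p)).const_sub (v p)).const_mul t
        simpa using this
      have := ((hd.ofReal_comp.mul_const Complex.I).cexp).const_mul
        (((1 : α → ℝ) p : ℝ) : ℂ)
      refine this.congr_deriv ?_
      push_cast
      simp only [Pi.one_apply, Complex.ofReal_one]
      ring)
  refine hmain.2.congr_deriv ?_
  rw [integral_const_mul]
  rfl

end Oscillatory

/-! ### From Lebesgue averages over the pin to averages against `μ` -/

section LocalMean

open Set Filter Topology
open scoped NNReal

/-- A one-dimensional Sobolev inequality. -/
lemma mul_norm_sq_le_integral {H H' : ℝ → ℂ} (hd : ∀ y, HasDerivAt H (H' y) y)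
    (hc : Continuous H') {η : ℝ} (hη : 0 < η) (x : ℝ) :
    η * ‖H x‖ ^ 2 ≤ ∫ y in x..x + η, (2 * ‖H y‖ ^ 2 + η ^ 2 * ‖H' y‖ ^ 2) := by
  have hH : Continuous H := continuous_iff_continuousAt.2 fun y => (hd y).continuousAt
  -- This dominates the derivative of `‖H‖^2` in absolute value. Averaging over an interval of
  -- length `η` then gives one `‖H‖^2` from the mean and one from `g`, hence the factor `2`.
  set g : ℝ → ℝ := fun y => η⁻¹ * ‖H y‖ ^ 2 + η * ‖H' y‖ ^ 2 with hg
  have hgc : Continuous g := by fun_prop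
  have hg0 : ∀ y, 0 ≤ g y := fun y => by positivity
  have hder : ∀ y, HasDerivAt (fun y => ‖H y‖ ^ 2) (2 * inner ℝ (H y) (H' y)) y :=
    fun y => (hd y).norm_sq
  have hic : Continuous fun y => 2 * inner ℝ (H y) (H' y) := by fun_prop
  have hbound : ∀ y, -(2 * inner ℝ (H y) (H' y)) ≤ g y := fun y => by
    have h1 := neg_le_of_abs_le (abs_real_inner_le_norm (H y) (H' y))
    have h2 : 2 * (‖H y‖ * ‖H' y‖) ≤ g y := by
      have e : g y - 2 * (‖H y‖ * ‖H' y‖) = η⁻¹ * (‖H y‖ - η * ‖H' y‖) ^ 2 := by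
        rw [hg]; field_simp; ring
      have : 0 ≤ η⁻¹ * (‖H y‖ - η * ‖H' y‖) ^ 2 := by positivity
      linarith
    linarith
  have hpt : ∀ y ∈ Icc x (x + η), ‖H x‖ ^ 2 ≤ ‖H y‖ ^ 2 + ∫ z in x..x + η, g z := by
    intro y hy
    have h1 := intervalIntegral.integral_eq_sub_of_hasDerivAt (a := x) (b := y)
      (fun z _ => hder z) (hic.intervalIntegrable _ _)
    have h2 : ∫ z in x..y, -(2 * inner ℝ (H z) (H' z)) ≤ ∫ z in x..y, g z :=
      intervalIntegral.integral_mono_on hy.1 (hic.neg.intervalIntegrable _ _)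
        (hgc.intervalIntegrable _ _) fun z _ => hbound z
    have h3 : ∫ z in x..y, g z ≤ ∫ z in x..x + η, g z :=
      intervalIntegral.integral_mono_interval le_rfl hy.1 hy.2
        (Eventually.of_forall hg0) (hgc.intervalIntegrable _ _)
    rw [intervalIntegral.integral_neg] at h2
    linarith
  calc η * ‖H x‖ ^ 2 = ∫ _ in x..x + η, ‖H x‖ ^ 2 := by simp
    _ ≤ ∫ y in x..x + η, (‖H y‖ ^ 2 + ∫ z in x..x + η, g z) :=
        intervalIntegral.integral_mono_on (by linarith) (by simp)
          (by apply Continuous.intervalIntegrable; fun_prop) hpt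
    _ = (∫ y in x..x + η, ‖H y‖ ^ 2) + η * ∫ z in x..x + η, g z := by
        rw [intervalIntegral.integral_add
          (by apply Continuous.intervalIntegrable; fun_prop) (by simp)]
        simp
    _ = ∫ y in x..x + η, (2 * ‖H y‖ ^ 2 + η ^ 2 * ‖H' y‖ ^ 2) := by
        rw [← intervalIntegral.integral_const_mul, ← intervalIntegral.integral_add
          (by apply Continuous.intervalIntegrable; fun_prop)
          (by apply Continuous.intervalIntegrable; fun_prop)]
        congr 1
        ext y
        rw [hg]
        field_simp
        ring

/-- By Fubini, a given `y` is met only by those `x` in an interval of length `η`, of `μ`-mass at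
most `η^(3/4)`. The Gaussian weight costs a constant, since `η ≤ 1` keeps `|y| ≤ L + 1`. -/
lemma lintegral_lintegral_Ioc_le {μ : Measure ℝ} [IsFiniteMeasure μ]
    (hμ : ∀ a b : ℝ, a ≤ b → μ (Icc a b) ≤ ENNReal.ofReal ((b - a) ^ (3 / 4 : ℝ)))
    {L : ℝ} (hL : ∀ᵐ x ∂μ, x ∈ Icc (-L) L) {η : ℝ} (hη : 0 < η) (hη1 : η ≤ 1)
    {g : ℝ → ℝ≥0∞} (hg : Measurable g) :
    ∫⁻ x, (∫⁻ y in Ioc x (x + η), g y) ∂μ ≤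
      ENNReal.ofReal (Real.exp ((L + 1) ^ 2)) * ENNReal.ofReal (η ^ (3 / 4 : ℝ)) *
        ∫⁻ y, ENNReal.ofReal (Real.exp (-y ^ 2)) * g y := by
  set h : ℝ → ℝ≥0∞ := fun y =>
    ENNReal.ofReal (Real.exp ((L + 1) ^ 2)) * (ENNReal.ofReal (Real.exp (-y ^ 2)) * g y) with hh
  have hhm : Measurable h := by fun_prop
  have hS : MeasurableSet {q : ℝ × ℝ | q.1 < q.2 ∧ q.2 ≤ q.1 + η} :=
    (measurableSet_lt measurable_fst measurable_snd).inter
      (measurableSet_le measurable_snd (by fun_prop))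
  have hind : ∀ x y, (Ioc x (x + η)).indicator h y =
      {q : ℝ × ℝ | q.1 < q.2 ∧ q.2 ≤ q.1 + η}.indicator (fun q => h q.2) (x, y) := fun x y => by
    simp [indicator]
  calc ∫⁻ x, (∫⁻ y in Ioc x (x + η), g y) ∂μ
      ≤ ∫⁻ x, (∫⁻ y, (Ioc x (x + η)).indicator h y) ∂μ := by
        refine lintegral_mono_ae ?_
        filter_upwards [hL] with x hx
        rw [lintegral_indicator measurableSet_Ioc]
        refine setLIntegral_mono hhm fun y hy => ?_
        rw [hh]
        dsimp only
        rw [← mul_assoc, ← ENNReal.ofReal_mul (Real.exp_pos _).le, ← Real.exp_add]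
        have hy2 : y ^ 2 ≤ (L + 1) ^ 2 := by
          refine sq_le_sq' ?_ ?_
          · linarith [hx.1, hy.1]
          · linarith [hx.2, hy.2]
        have : (1 : ℝ≥0∞) ≤ ENNReal.ofReal (Real.exp ((L + 1) ^ 2 + -y ^ 2)) :=
          ENNReal.one_le_ofReal.2 (Real.one_le_exp (by linarith))
        calc g y = 1 * g y := (one_mul _).symm
          _ ≤ _ := by gcongr
    _ = ∫⁻ y, ∫⁻ x, (Ioc x (x + η)).indicator h y ∂μ := by
        refine lintegral_lintegral_swap ?_
        have : Measurable (Function.uncurry fun x y => (Ioc x (x + η)).indicator h y) := by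
          have e : (Function.uncurry fun x y => (Ioc x (x + η)).indicator h y) =
              {q : ℝ × ℝ | q.1 < q.2 ∧ q.2 ≤ q.1 + η}.indicator (fun q => h q.2) := by
            ext ⟨x, y⟩
            exact hind x y
          rw [e]
          exact (hhm.comp measurable_snd).indicator hS
        exact this.aemeasurable
    _ ≤ ∫⁻ y, h y * ENNReal.ofReal (η ^ (3 / 4 : ℝ)) := by
        refine lintegral_mono fun y => ?_
        calc ∫⁻ x, (Ioc x (x + η)).indicator h y ∂μ
            ≤ ∫⁻ x, (Icc (y - η) y).indicator (fun _ => h y) x ∂μ := by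
              refine lintegral_mono fun x => ?_
              by_cases hx : y ∈ Ioc x (x + η)
              · rw [indicator_of_mem hx, indicator_of_mem]
                exact ⟨by linarith [hx.2], hx.1.le⟩
              · rw [indicator_of_notMem hx]; exact zero_le
          _ = h y * μ (Icc (y - η) y) := by
              rw [lintegral_indicator measurableSet_Icc]; simp
          _ ≤ h y * ENNReal.ofReal (η ^ (3 / 4 : ℝ)) := by
              gcongr
              refine (hμ _ _ (by linarith)).trans_eq ?_
              rw [sub_sub_cancel]
    _ = _ := by
        rw [lintegral_mul_const _ hhm, hh, lintegral_const_mul _ (by fun_prop)]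
        ring

variable {α : Type*} [MeasurableSpace α]

/-- At frequency `t`, the square mean of the oscillatory integral over a measure of dimension
`3 / 4` is controlled by smooth means, with a loss of `|t| ^ (1 / 4)`. -/
lemma lintegral_norm_oscIntegral_sq_le {μ : Measure ℝ} [IsFiniteMeasure μ]
    (hμ : ∀ a b : ℝ, a ≤ b → μ (Icc a b) ≤ ENNReal.ofReal ((b - a) ^ (3 / 4 : ℝ)))
    {L : ℝ} (hL : ∀ᵐ x ∂μ, x ∈ Icc (-L) L) {F : Measure α} [IsFiniteMeasure F] {u v : α → ℝ}
    (hu : Measurable u) (hv : Measurable v) (hui : Integrable u F) {t : ℝ} (ht : 1 ≤ |t|) :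
    ∫⁻ x, ENNReal.ofReal (‖oscIntegral F u v 1 x t‖ ^ 2) ∂μ ≤
      ENNReal.ofReal (Real.exp ((L + 1) ^ 2)) * ENNReal.ofReal (|t| ^ (1 / 4 : ℝ)) *
        ∫⁻ y, ENNReal.ofReal (Real.exp (-y ^ 2)) * ENNReal.ofReal
          (2 * ‖oscIntegral F u v 1 y t‖ ^ 2 +
            ‖oscIntegral F u v (fun p => 2 * u p) y t‖ ^ 2) := by
  have ht0 : 0 < |t| := by linarith
  -- At the scale `|t|⁻¹` the factor `η^2` cancels the `t^2` produced by the derivative. The loss is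
  -- then `|t| * |t|^(-3/4)`.
  have hη : 0 < |t|⁻¹ := by positivity
  have hc1 : Continuous fun y => oscIntegral F u v 1 y t :=
    (continuous_oscIntegral hu hv (integrable_const _)).comp (Continuous.prodMk_right t)
  have hc2 : Continuous fun y => oscIntegral F u v (fun p => 2 * u p) y t :=
    (continuous_oscIntegral hu hv (hui.const_mul 2)).comp (Continuous.prodMk_right t)
  set g : ℝ → ℝ := fun y => 2 * ‖oscIntegral F u v 1 y t‖ ^ 2 +
    ‖oscIntegral F u v (fun p => 2 * u p) y t‖ ^ 2 with hg
  have hgc : Continuous g := by fun_prop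
  have hg0 : ∀ y, 0 ≤ g y := fun y => by positivity
  have hpt : ∀ x, ENNReal.ofReal (‖oscIntegral F u v 1 x t‖ ^ 2) ≤
      ENNReal.ofReal |t| * ∫⁻ y in Ioc x (x + |t|⁻¹), ENNReal.ofReal (g y) := by
    intro x
    have h := mul_norm_sq_le_integral (fun y => hasDerivAt_oscIntegral hu hv hui y t)
      (by fun_prop) hη x
    have e : ∀ y, 2 * ‖oscIntegral F u v 1 y t‖ ^ 2 + |t|⁻¹ ^ 2 *
        ‖-(t : ℂ) * Complex.I * oscIntegral F u v (fun p => 2 * u p) y t‖ ^ 2 = g y := by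
      intro y
      rw [hg, norm_mul, norm_mul, norm_neg, Complex.norm_real, Complex.norm_I, mul_one,
        Real.norm_eq_abs]
      field_simp
    simp_rw [e] at h
    rw [← ofReal_integral_eq_lintegral_ofReal (hgc.integrableOn_Ioc) (Eventually.of_forall hg0),
      ← ENNReal.ofReal_mul ht0.le, ← intervalIntegral.integral_of_le (by linarith)]
    refine ENNReal.ofReal_le_ofReal ?_
    rwa [inv_mul_le_iff₀ ht0] at h
  calc ∫⁻ x, ENNReal.ofReal (‖oscIntegral F u v 1 x t‖ ^ 2) ∂μ
      ≤ ∫⁻ x, (ENNReal.ofReal |t| * ∫⁻ y in Ioc x (x + |t|⁻¹), ENNReal.ofReal (g y)) ∂μ :=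
        lintegral_mono hpt
    _ = ENNReal.ofReal |t| * ∫⁻ x, (∫⁻ y in Ioc x (x + |t|⁻¹), ENNReal.ofReal (g y)) ∂μ :=
        lintegral_const_mul' _ _ ENNReal.ofReal_ne_top
    _ ≤ ENNReal.ofReal |t| * (ENNReal.ofReal (Real.exp ((L + 1) ^ 2)) *
          ENNReal.ofReal (|t|⁻¹ ^ (3 / 4 : ℝ)) *
          ∫⁻ y, ENNReal.ofReal (Real.exp (-y ^ 2)) * ENNReal.ofReal (g y)) := by
        gcongr
        exact lintegral_lintegral_Ioc_le hμ hL hη (inv_le_one_of_one_le₀ ht)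
          (by fun_prop)
    _ = _ := by
        have e : |t| ^ (1 / 4 : ℝ) = |t| * |t|⁻¹ ^ (3 / 4 : ℝ) := by
          rw [Real.inv_rpow ht0.le, ← Real.rpow_neg ht0.le]
          conv_rhs => rw [← Real.rpow_one |t|, ← Real.rpow_mul ht0.le, one_mul,
            ← Real.rpow_add ht0]
          norm_num
        rw [e, ENNReal.ofReal_mul ht0.le]
        ring

end LocalMean

/-! ### Decay of the Gaussian-averaged square mean -/

section SquareIntegrability

open Set Filter Topology
open scoped NNReal

lemma norm_oscIntegral_le {α : Type*} [MeasurableSpace α] (F : Measure α) (u v a : α → ℝ)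
    (x t : ℝ) : ‖oscIntegral F u v a x t‖ ≤ ∫ p, ‖a p‖ ∂F :=
  (norm_integral_le_integral_norm _).trans_eq (by simp_rw [norm_oscIntegrand])

lemma lintegral_prod_rpow_mul_rpow_le {μ₁ μ₂ : Measure ℝ} [IsFiniteMeasure μ₁]
    [IsFiniteMeasure μ₂] {δ : ℝ} {T : ℝ≥0∞}
    (h₁ : ∀ y, ∫⁻ y', ENNReal.ofReal ((δ ^ 2 + (y - y') ^ 2) ^ (-(3 / 4) : ℝ)) ∂μ₁ ≤ T)
    (h₂ : ∀ y, ∫⁻ y', ENNReal.ofReal ((δ ^ 2 + (y - y') ^ 2) ^ (-(3 / 4) : ℝ)) ∂μ₂ ≤ T) :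
    ∫⁻ r : (ℝ × ℝ) × (ℝ × ℝ), ENNReal.ofReal ((δ ^ 2 + (r.1.1 - r.2.1) ^ 2) ^ (-(3 / 4) : ℝ)) *
        ENNReal.ofReal ((δ ^ 2 + (r.1.2 - r.2.2) ^ 2) ^ (-(3 / 4) : ℝ))
        ∂((μ₁.prod μ₂).prod (μ₁.prod μ₂)) ≤ T * T * (μ₁.prod μ₂) univ := by
  rw [lintegral_prod _ (by fun_prop)]
  calc _ ≤ ∫⁻ _ : ℝ × ℝ, T * T ∂(μ₁.prod μ₂) := by
        refine lintegral_mono fun p => ?_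
        dsimp only
        rw [lintegral_prod_mul (f := fun y' : ℝ =>
            ENNReal.ofReal ((δ ^ 2 + (p.1 - y') ^ 2) ^ (-(3 / 4) : ℝ)))
          (g := fun y' : ℝ => ENNReal.ofReal ((δ ^ 2 + (p.2 - y') ^ 2) ^ (-(3 / 4) : ℝ)))
          (by fun_prop) (by fun_prop)]
        exact mul_le_mul' (h₁ _) (h₂ _)
    _ = _ := by simp

variable {μ : Measure ℝ} [IsFiniteMeasure μ] {a b g : ℝ}

/-- The product of the restrictions of `μ` to the intervals of radius `g` about `a` and `b`. -/
noncomputable def separatedProd (μ : Measure ℝ) (a b g : ℝ) : Measure (ℝ × ℝ) :=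
  (μ.restrict (Icc (a - g) (a + g))).prod (μ.restrict (Icc (b - g) (b + g)))

instance : IsFiniteMeasure (separatedProd μ a b g) := by
  unfold separatedProd; infer_instance

lemma separatedProd_eq_restrict : separatedProd μ a b g =
    (μ.prod μ).restrict (Icc (a - g) (a + g) ×ˢ Icc (b - g) (b + g)) :=
  Measure.prod_restrict _ _

lemma ae_mem_separatedProd :
    ∀ᵐ p ∂(separatedProd μ a b g), p ∈ Icc (a - g) (a + g) ×ˢ Icc (b - g) (b + g) := by
  rw [separatedProd_eq_restrict]
  exact ae_restrict_mem (measurableSet_Icc.prod measurableSet_Icc)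

/-- The kernel is bounded by `δ^2` times a product of one-variable kernels. Each integrates to at
most a multiple of `δ^(-3/4)`, which leaves `δ^(1/2)`. -/
lemma lintegral_gaussianKernel_le
    (hμ : ∀ a b : ℝ, a ≤ b → μ (Icc a b) ≤ ENNReal.ofReal ((b - a) ^ (3 / 4 : ℝ)))
    (hg : 0 < g) (hab : |b - a| = 3 * g) :
    ∃ C : ℝ≥0∞, C ≠ ⊤ ∧ ∀ δ : ℝ, 0 < δ →
      ∫⁻ r : (ℝ × ℝ) × (ℝ × ℝ), ENNReal.ofReal
        |gaussianKernel ((r.1.1 ^ 2 + r.1.2 ^ 2) - (r.2.1 ^ 2 + r.2.2 ^ 2))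
            (δ ^ 2 + ((r.1.1 + r.1.2) - (r.2.1 + r.2.2)) ^ 2) -
          gaussianKernel ((r.1.1 ^ 2 + r.1.2 ^ 2) - (r.2.1 ^ 2 + r.2.2 ^ 2))
            (δ ^ 2 + ((r.1.1 + r.1.2) - (r.2.1 + r.2.2)) ^ 2 + δ ^ 2)|
        ∂((separatedProd μ a b g).prod (separatedProd μ a b g)) ≤
      C * ENNReal.ofReal (δ ^ (1 / 2 : ℝ)) := by
  obtain ⟨C₀, hC₀, hC⟩ := exists_lintegral_rpow_le hμ
  set K := (4 + 16 * (|a| + |b| + g) ^ 2) / (4 * g ^ 2) with hK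
  have hK0 : 0 ≤ K := by positivity
  set P := 1728 * Real.sqrt Real.pi * (K + 1) ^ (3 / 2 : ℝ) with hP
  have hP0 : 0 ≤ P := by positivity
  refine ⟨ENNReal.ofReal P * (C₀ * C₀ * separatedProd μ a b g univ),
    ENNReal.mul_ne_top ENNReal.ofReal_ne_top (ENNReal.mul_ne_top (ENNReal.mul_ne_top hC₀ hC₀)
      (measure_ne_top _ _)), fun δ hδ => ?_⟩
  have hmem : ∀ᵐ r ∂((separatedProd μ a b g).prod (separatedProd μ a b g)),
      r ∈ (Icc (a - g) (a + g) ×ˢ Icc (b - g) (b + g)) ×ˢ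
        (Icc (a - g) (a + g) ×ˢ Icc (b - g) (b + g)) := by
    rw [separatedProd_eq_restrict, Measure.prod_restrict]
    exact ae_restrict_mem ((measurableSet_Icc.prod measurableSet_Icc).prod
      (measurableSet_Icc.prod measurableSet_Icc))
  calc _ ≤ ∫⁻ r : (ℝ × ℝ) × (ℝ × ℝ), ENNReal.ofReal (P * δ ^ 2) *
        (ENNReal.ofReal ((δ ^ 2 + (r.1.1 - r.2.1) ^ 2) ^ (-(3 / 4) : ℝ)) *
        ENNReal.ofReal ((δ ^ 2 + (r.1.2 - r.2.2) ^ 2) ^ (-(3 / 4) : ℝ)))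
        ∂((separatedProd μ a b g).prod (separatedProd μ a b g)) := by
        refine lintegral_mono_ae ?_
        filter_upwards [hmem] with r hr
        rw [← ENNReal.ofReal_mul (by positivity), ← ENNReal.ofReal_mul (by positivity)]
        refine ENNReal.ofReal_le_ofReal ?_
        have hsep := sq_add_sq_le_of_separated hg hab hr.1.1 hr.2.1 hr.1.2 hr.2.2
        set U := (r.1.1 + r.1.2) - (r.2.1 + r.2.2)
        set V := (r.1.1 ^ 2 + r.1.2 ^ 2) - (r.2.1 ^ 2 + r.2.2 ^ 2)
        have hle := rpow_neg_three_halves_le_mul hK0 (sq_pos_of_pos hδ) hsep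
          (by positivity : 0 ≤ U ^ 2 + V ^ 2)
        calc _ ≤ 1728 * Real.sqrt Real.pi * (δ ^ 2 + U ^ 2 + V ^ 2) ^ (-(3 / 2) : ℝ) * δ ^ 2 :=
              abs_gaussianKernel_sub_le V (by positivity) (by positivity)
          _ ≤ 1728 * Real.sqrt Real.pi * ((K + 1) ^ (3 / 2 : ℝ) *
                ((δ ^ 2 + (r.1.1 - r.2.1) ^ 2) ^ (-(3 / 4) : ℝ) *
                (δ ^ 2 + (r.1.2 - r.2.2) ^ 2) ^ (-(3 / 4) : ℝ))) * δ ^ 2 := by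
              rw [add_assoc]
              gcongr
          _ = _ := by rw [hP]; ring
    _ = ENNReal.ofReal (P * δ ^ 2) * ∫⁻ r : (ℝ × ℝ) × (ℝ × ℝ),
        ENNReal.ofReal ((δ ^ 2 + (r.1.1 - r.2.1) ^ 2) ^ (-(3 / 4) : ℝ)) *
        ENNReal.ofReal ((δ ^ 2 + (r.1.2 - r.2.2) ^ 2) ^ (-(3 / 4) : ℝ))
        ∂((separatedProd μ a b g).prod (separatedProd μ a b g)) :=
        lintegral_const_mul' _ _ ENNReal.ofReal_ne_top
    _ ≤ ENNReal.ofReal (P * δ ^ 2) * ((C₀ * ENNReal.ofReal (δ ^ (-(3 / 4) : ℝ))) *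
          (C₀ * ENNReal.ofReal (δ ^ (-(3 / 4) : ℝ))) * separatedProd μ a b g univ) := by
        gcongr
        refine lintegral_prod_rpow_mul_rpow_le (fun y => ?_) (fun y => ?_)
        · exact (lintegral_mono' Measure.restrict_le_self le_rfl).trans (hC δ hδ y)
        · exact (lintegral_mono' Measure.restrict_le_self le_rfl).trans (hC δ hδ y)
    _ = _ := by
        have e : δ ^ (1 / 2 : ℝ) = δ ^ 2 * (δ ^ (-(3 / 4) : ℝ) * δ ^ (-(3 / 4) : ℝ)) := by
          rw [← Real.rpow_natCast, ← Real.rpow_add hδ, ← Real.rpow_add hδ]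
          norm_num
        clear_value P
        rw [e, ENNReal.ofReal_mul hP0, ENNReal.ofReal_mul (by positivity),
          ENNReal.ofReal_mul (by positivity)]
        ring

lemma lintegral_gaussianBand_oscIntegral_le
    (hμ : ∀ a b : ℝ, a ≤ b → μ (Icc a b) ≤ ENNReal.ofReal ((b - a) ^ (3 / 4 : ℝ)))
    (hg : 0 < g) (hab : |b - a| = 3 * g) {A : ℝ × ℝ → ℝ} (hA : Measurable A) {M : ℝ}
    (hAM : ∀ p ∈ Icc (a - g) (a + g) ×ˢ Icc (b - g) (b + g), |A p| ≤ M) :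
    ∃ C : ℝ≥0∞, C ≠ ⊤ ∧ ∀ δ : ℝ, 0 < δ →
      ∫⁻ t, ENNReal.ofReal (gaussianBand δ t) * ∫⁻ y, ENNReal.ofReal (Real.exp (-y ^ 2)) *
        ENNReal.ofReal (‖oscIntegral (separatedProd μ a b g) (fun p => p.1 + p.2)
          (fun p => p.1 ^ 2 + p.2 ^ 2) A y t‖ ^ 2) ≤ C * ENNReal.ofReal (δ ^ (1 / 2 : ℝ)) := by
  obtain ⟨C, hC, hle⟩ := lintegral_gaussianKernel_le (μ := μ) hμ hg hab
  refine ⟨ENNReal.ofReal (Real.sqrt Real.pi) * (ENNReal.ofReal (M * M) * C),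
    ENNReal.mul_ne_top ENNReal.ofReal_ne_top (ENNReal.mul_ne_top ENNReal.ofReal_ne_top hC),
    fun δ hδ => ?_⟩
  set F := separatedProd μ a b g with hF
  set u : ℝ × ℝ → ℝ := fun p => p.1 + p.2 with hu
  set v : ℝ × ℝ → ℝ := fun p => p.1 ^ 2 + p.2 ^ 2 with hv
  have hum : Measurable u := by fun_prop
  have hvm : Measurable v := by fun_prop
  have hAi : Integrable A F := by
    refine Integrable.of_bound hA.aestronglyMeasurable M ?_
    filter_upwards [ae_mem_separatedProd] with p hp using hAM p hp
  have hcont := continuous_oscIntegral hum hvm hAi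
  set w : ℝ × ℝ → ℝ := fun s => (gaussianBand δ s.1 * Real.exp (-s.2 ^ 2)) *
    ‖oscIntegral F u v A s.2 s.1‖ ^ 2 with hw
  have hw0 : ∀ s, 0 ≤ w s := fun s =>
    mul_nonneg (mul_nonneg (gaussianBand_nonneg _ _) (Real.exp_pos _).le) (sq_nonneg _)
  have hwi : Integrable w (volume.prod volume) := by
    refine (integrable_gaussianBand_mul_exp hδ).mul_bdd (c := (∫ p, ‖A p‖ ∂F) ^ 2)
      (hcont.norm.pow 2).aestronglyMeasurable (Eventually.of_forall fun s => ?_)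
    rw [Real.norm_of_nonneg (sq_nonneg _)]
    gcongr
    exact norm_oscIntegral_le _ _ _ _ _ _
  have hwm : Measurable fun s => ENNReal.ofReal (w s) := by fun_prop
  calc _ = ∫⁻ s : ℝ × ℝ, ENNReal.ofReal (w s) ∂(volume.prod volume) := by
        rw [lintegral_prod _ hwm.aemeasurable]
        refine lintegral_congr fun t => ?_
        rw [← lintegral_const_mul' _ _ ENNReal.ofReal_ne_top]
        refine lintegral_congr fun y => ?_
        rw [hw]
        dsimp only
        rw [ENNReal.ofReal_mul (mul_nonneg (gaussianBand_nonneg _ _) (Real.exp_pos _).le),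
          ENNReal.ofReal_mul (gaussianBand_nonneg _ _), mul_assoc]
    _ = ENNReal.ofReal (∫ s, w s ∂(volume.prod volume)) :=
        (ofReal_integral_eq_lintegral_ofReal hwi (Eventually.of_forall hw0)).symm
    _ ≤ ENNReal.ofReal (Real.sqrt Real.pi) * (ENNReal.ofReal (M * M) *
          (C * ENNReal.ofReal (δ ^ (1 / 2 : ℝ)))) := by
        rw [hw, integral_gaussianBand_norm_oscIntegral_sq hum hvm hAi hδ,
          ENNReal.ofReal_mul (Real.sqrt_nonneg _)]
        gcongr
        refine (ENNReal.ofReal_le_ofReal (le_abs_self _)).trans ?_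
        rw [← Real.norm_eq_abs, ofReal_norm]
        refine (enorm_integral_le_lintegral_enorm _).trans ?_
        refine le_trans ?_ (mul_le_mul_right (hle δ hδ) _)
        rw [← lintegral_const_mul' _ _ ENNReal.ofReal_ne_top]
        refine lintegral_mono_ae ?_
        have hmem : ∀ᵐ r ∂(F.prod F),
            r ∈ (Icc (a - g) (a + g) ×ˢ Icc (b - g) (b + g)) ×ˢ
              (Icc (a - g) (a + g) ×ˢ Icc (b - g) (b + g)) := by
          rw [hF, separatedProd_eq_restrict, Measure.prod_restrict]
          exact ae_restrict_mem ((measurableSet_Icc.prod measurableSet_Icc).prod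
            (measurableSet_Icc.prod measurableSet_Icc))
        filter_upwards [hmem] with r hr
        have h1 := hAM _ hr.1
        have h2 := hAM _ hr.2
        have hM : 0 ≤ M := (abs_nonneg _).trans h1
        rw [enorm_mul, ← ofReal_norm, ← ofReal_norm, Real.norm_eq_abs, Real.norm_eq_abs, abs_mul]
        gcongr
    _ = _ := by ring

/-- With `X = (t/R)^2` between `1` and `4`, the band equals `exp (-X) (1 - exp (-X))`, and the
factors are at least `exp (-4)` and `1/2`. -/
lemma one_le_gaussianBand {R t : ℝ} (hR : 0 < R) (h1 : R ≤ |t|) (h2 : |t| ≤ 2 * R) :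
    1 ≤ 2 * Real.exp 4 * gaussianBand R⁻¹ t := by
  have e : R⁻¹ ^ 2 * t ^ 2 = (|t| / R) ^ 2 := by rw [div_pow, sq_abs, inv_pow]; ring
  have b1 : 1 ≤ |t| / R := (one_le_div hR).2 h1
  have b2 : |t| / R ≤ 2 := (div_le_iff₀ hR).2 h2
  set X := (|t| / R) ^ 2 with hX
  have hX1 : 1 ≤ X := by nlinarith
  have hX4 : X ≤ 4 := by nlinarith
  have e1 : gaussianBand R⁻¹ t = Real.exp (-X) * (1 - Real.exp (-X)) := by
    rw [gaussianBand, mul_one_sub, ← Real.exp_add]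
    congr 2
    · linarith
    · linarith
  have h3 : Real.exp (-X) ≤ 1 / 2 := by
    rw [Real.exp_neg, one_div]
    exact inv_anti₀ two_pos (by linarith [Real.add_one_le_exp X])
  have h4 : 1 ≤ Real.exp 4 * Real.exp (-X) := by
    rw [← Real.exp_add]
    exact Real.one_le_exp (by linarith)
  rw [e1]
  calc (1 : ℝ) = 2 * 1 * (1 / 2) := by norm_num
    _ ≤ 2 * (Real.exp 4 * Real.exp (-X)) * (1 - Real.exp (-X)) := by
      gcongr
      linarith
    _ = _ := by ring

end SquareIntegrability

/-! ### Dyadic summation, choice of the pin, and the null set contradiction -/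

section PinnedBoxSet

open Set Filter Topology
open scoped NNReal

variable {μ : Measure ℝ} [IsFiniteMeasure μ] {a b g : ℝ}

lemma abs_add_le_of_mem_prod {p : ℝ × ℝ}
    (hp : p ∈ Icc (a - g) (a + g) ×ˢ Icc (b - g) (b + g)) :
    |p.1 + p.2| ≤ |a| + |b| + 2 * g := by
  obtain ⟨⟨h1, h2⟩, h3, h4⟩ := hp
  rw [abs_le]
  constructor <;> linarith [neg_abs_le a, neg_abs_le b, le_abs_self a, le_abs_self b]

/-- The loss `R^(1/4)` from replacing Lebesgue measure by `μ` meets the gain `(1/R)^(1/2)` of the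
band estimate, applied to the amplitudes `1` and `2u`. -/
lemma setLIntegral_dyadic_oscIntegral_le
    (hμ : ∀ a b : ℝ, a ≤ b → μ (Icc a b) ≤ ENNReal.ofReal ((b - a) ^ (3 / 4 : ℝ)))
    (hg : 0 < g) (hab : |b - a| = 3 * g) {L : ℝ} (hL : ∀ᵐ x ∂μ, x ∈ Icc (-L) L) :
    ∃ C : ℝ≥0∞, C ≠ ⊤ ∧ ∀ R : ℝ, 1 ≤ R →
      ∫⁻ t in {t : ℝ | R ≤ |t| ∧ |t| ≤ 2 * R}, (∫⁻ x, ENNReal.ofReal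
        (‖oscIntegral (separatedProd μ a b g) (fun p => p.1 + p.2)
          (fun p => p.1 ^ 2 + p.2 ^ 2) 1 x t‖ ^ 2) ∂μ) ≤
        C * ENNReal.ofReal (R ^ (-(1 / 4) : ℝ)) := by
  set N := |a| + |b| + 2 * g with hN
  obtain ⟨C₁, hC₁, h₁⟩ := lintegral_gaussianBand_oscIntegral_le (μ := μ) hμ hg hab
    (A := 1) measurable_one (M := 1) (fun p _ => by simp)
  obtain ⟨C₂, hC₂, h₂⟩ := lintegral_gaussianBand_oscIntegral_le (μ := μ) hμ hg hab
    (A := fun p => 2 * (p.1 + p.2)) (by fun_prop) (M := 2 * N) (fun p hp => by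
      rw [abs_mul, abs_two]
      have := abs_add_le_of_mem_prod hp
      gcongr)
  set F := separatedProd μ a b g with hF
  set u : ℝ × ℝ → ℝ := fun p => p.1 + p.2 with hu
  set v : ℝ × ℝ → ℝ := fun p => p.1 ^ 2 + p.2 ^ 2 with hv
  have hum : Measurable u := by fun_prop
  have hvm : Measurable v := by fun_prop
  have hui : Integrable u F := by
    refine Integrable.of_bound hum.aestronglyMeasurable N ?_
    filter_upwards [ae_mem_separatedProd] with p hp using abs_add_le_of_mem_prod hp
  have hm₁ : Measurable fun s : ℝ × ℝ =>
      ENNReal.ofReal (‖oscIntegral F u v 1 s.2 s.1‖ ^ 2) :=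
    ((continuous_oscIntegral hum hvm (integrable_const _)).norm.pow 2).measurable.ennreal_ofReal
  have hm₂ : Measurable fun s : ℝ × ℝ =>
      ENNReal.ofReal (‖oscIntegral F u v (fun p => 2 * u p) s.2 s.1‖ ^ 2) :=
    ((continuous_oscIntegral hum hvm (hui.const_mul 2)).norm.pow 2).measurable.ennreal_ofReal
  set Q₁ : ℝ → ℝ≥0∞ := fun t => ∫⁻ y, ENNReal.ofReal (Real.exp (-y ^ 2)) *
    ENNReal.ofReal (‖oscIntegral F u v 1 y t‖ ^ 2) with hQ₁
  set Q₂ : ℝ → ℝ≥0∞ := fun t => ∫⁻ y, ENNReal.ofReal (Real.exp (-y ^ 2)) *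
    ENNReal.ofReal (‖oscIntegral F u v (fun p => 2 * u p) y t‖ ^ 2) with hQ₂
  have hQm₁ : Measurable Q₁ := Measurable.lintegral_prod_right' (f := fun s : ℝ × ℝ =>
    ENNReal.ofReal (Real.exp (-s.2 ^ 2)) * ENNReal.ofReal (‖oscIntegral F u v 1 s.2 s.1‖ ^ 2))
    (Measurable.mul (by fun_prop) hm₁)
  have hQm₂ : Measurable Q₂ := Measurable.lintegral_prod_right' (f := fun s : ℝ × ℝ =>
    ENNReal.ofReal (Real.exp (-s.2 ^ 2)) *
      ENNReal.ofReal (‖oscIntegral F u v (fun p => 2 * u p) s.2 s.1‖ ^ 2))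
    (Measurable.mul (by fun_prop) hm₂)
  set B := ENNReal.ofReal (Real.exp ((L + 1) ^ 2)) with hB
  have hpt : ∀ t : ℝ, 1 ≤ |t| →
      ∫⁻ x, ENNReal.ofReal (‖oscIntegral F u v 1 x t‖ ^ 2) ∂μ ≤
        B * ENNReal.ofReal (|t| ^ (1 / 4 : ℝ)) * (2 * Q₁ t + Q₂ t) := by
    intro t ht
    refine (lintegral_norm_oscIntegral_sq_le hμ hL hum hvm hui ht).trans_eq ?_
    congr 1
    have hmt : Measurable fun y => ENNReal.ofReal (Real.exp (-y ^ 2)) *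
        ENNReal.ofReal (‖oscIntegral F u v 1 y t‖ ^ 2) :=
      Measurable.mul (by fun_prop) (hm₁.comp measurable_prodMk_left)
    rw [hQ₁, hQ₂]
    dsimp only
    rw [← lintegral_const_mul _ hmt, ← lintegral_add_left (hmt.const_mul 2)]
    refine lintegral_congr fun y => ?_
    rw [ENNReal.ofReal_add (by positivity) (by positivity), ENNReal.ofReal_mul two_pos.le,
      ENNReal.ofReal_ofNat]
    ring
  set D : ℝ≥0∞ := B * ENNReal.ofReal (2 ^ (1 / 4 : ℝ)) * ENNReal.ofReal (2 * Real.exp 4) with hD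
  have hDtop : D ≠ ⊤ := ENNReal.mul_ne_top
    (ENNReal.mul_ne_top ENNReal.ofReal_ne_top ENNReal.ofReal_ne_top) ENNReal.ofReal_ne_top
  refine ⟨D * (2 * C₁ + C₂), ENNReal.mul_ne_top hDtop (ENNReal.add_ne_top.2
    ⟨ENNReal.mul_ne_top (by simp) hC₁, hC₂⟩), fun R hR => ?_⟩
  have hR0 : 0 < R := by linarith
  have hwm : Measurable fun t => ENNReal.ofReal (gaussianBand R⁻¹ t) := by fun_prop
  calc _ ≤ ∫⁻ t in {t : ℝ | R ≤ |t| ∧ |t| ≤ 2 * R}, D * ENNReal.ofReal (R ^ (1 / 4 : ℝ)) *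
        (ENNReal.ofReal (gaussianBand R⁻¹ t) * (2 * Q₁ t + Q₂ t)) := by
        refine setLIntegral_mono (by fun_prop) fun t ht => ?_
        refine (hpt t (hR.trans ht.1)).trans ?_
        have hband := one_le_gaussianBand hR0 ht.1 ht.2
        have h1 : ENNReal.ofReal (|t| ^ (1 / 4 : ℝ)) ≤
            ENNReal.ofReal (2 ^ (1 / 4 : ℝ)) * ENNReal.ofReal (R ^ (1 / 4 : ℝ)) := by
          rw [← ENNReal.ofReal_mul (by positivity), ← Real.mul_rpow two_pos.le hR0.le]
          exact ENNReal.ofReal_le_ofReal (Real.rpow_le_rpow (abs_nonneg _) ht.2 (by norm_num))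
        have h2 : 1 ≤ ENNReal.ofReal (2 * Real.exp 4) * ENNReal.ofReal (gaussianBand R⁻¹ t) := by
          rw [← ENNReal.ofReal_mul (by positivity)]
          exact ENNReal.one_le_ofReal.2 hband
        calc B * ENNReal.ofReal (|t| ^ (1 / 4 : ℝ)) * (2 * Q₁ t + Q₂ t)
            = B * ENNReal.ofReal (|t| ^ (1 / 4 : ℝ)) * 1 * (2 * Q₁ t + Q₂ t) := by rw [mul_one]
          _ ≤ B * (ENNReal.ofReal (2 ^ (1 / 4 : ℝ)) * ENNReal.ofReal (R ^ (1 / 4 : ℝ))) *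
              (ENNReal.ofReal (2 * Real.exp 4) * ENNReal.ofReal (gaussianBand R⁻¹ t)) *
              (2 * Q₁ t + Q₂ t) := by gcongr
          _ = _ := by rw [hD]; ring
    _ ≤ ∫⁻ t, D * ENNReal.ofReal (R ^ (1 / 4 : ℝ)) *
        (ENNReal.ofReal (gaussianBand R⁻¹ t) * (2 * Q₁ t + Q₂ t)) :=
        setLIntegral_le_lintegral _ _
    _ = D * ENNReal.ofReal (R ^ (1 / 4 : ℝ)) *
          (2 * (∫⁻ t, ENNReal.ofReal (gaussianBand R⁻¹ t) * Q₁ t) +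
            ∫⁻ t, ENNReal.ofReal (gaussianBand R⁻¹ t) * Q₂ t) := by
        rw [lintegral_const_mul _ (by fun_prop)]
        congr 1
        rw [← lintegral_const_mul _ (by fun_prop), ← lintegral_add_left (by fun_prop)]
        refine lintegral_congr fun t => ?_
        ring
    _ ≤ D * ENNReal.ofReal (R ^ (1 / 4 : ℝ)) *
          (2 * (C₁ * ENNReal.ofReal (R⁻¹ ^ (1 / 2 : ℝ))) +
            C₂ * ENNReal.ofReal (R⁻¹ ^ (1 / 2 : ℝ))) := by
        gcongr
        · exact h₁ _ (by positivity)
        · exact h₂ _ (by positivity)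
    _ = _ := by
        have e : R ^ (-(1 / 4) : ℝ) = R ^ (1 / 4 : ℝ) * R⁻¹ ^ (1 / 2 : ℝ) := by
          rw [Real.inv_rpow hR0.le, ← Real.rpow_neg hR0.le, ← Real.rpow_add hR0]
          norm_num
        rw [e, ENNReal.ofReal_mul (by positivity)]
        ring

lemma lintegral_lintegral_oscIntegral_ne_top
    (hμ : ∀ a b : ℝ, a ≤ b → μ (Icc a b) ≤ ENNReal.ofReal ((b - a) ^ (3 / 4 : ℝ)))
    (hg : 0 < g) (hab : |b - a| = 3 * g) {L : ℝ} (hL : ∀ᵐ x ∂μ, x ∈ Icc (-L) L) :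
    ∫⁻ t, (∫⁻ x, ENNReal.ofReal (‖oscIntegral (separatedProd μ a b g) (fun p => p.1 + p.2)
      (fun p => p.1 ^ 2 + p.2 ^ 2) 1 x t‖ ^ 2) ∂μ) ≠ ⊤ := by
  obtain ⟨C, hC, hle⟩ := setLIntegral_dyadic_oscIntegral_le hμ hg hab hL
  set D : ℝ → ℝ≥0∞ := fun t => ∫⁻ x, ENNReal.ofReal
    (‖oscIntegral (separatedProd μ a b g) (fun p => p.1 + p.2)
      (fun p => p.1 ^ 2 + p.2 ^ 2) 1 x t‖ ^ 2) ∂μ with hD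
  set A : ℕ → Set ℝ := fun k => {t : ℝ | (2 : ℝ) ^ k ≤ |t| ∧ |t| ≤ 2 * 2 ^ k} with hA
  have hcover : Icc (-1 : ℝ) 1 ∪ (⋃ k, A k) = univ := by
    refine eq_univ_of_forall fun t => ?_
    rcases le_total |t| 1 with h | h
    · exact Or.inl (abs_le.1 h)
    · obtain ⟨k, hk1, hk2⟩ := exists_nat_pow_near h one_lt_two
      exact Or.inr (mem_iUnion.2 ⟨k, hk1, by rw [pow_succ] at hk2; linarith⟩)
  -- Low frequencies need no cancellation: the oscillatory integral is bounded by the total mass.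
  have hlow : ∫⁻ t in Icc (-1 : ℝ) 1, D t ≠ ⊤ := by
    set M := (∫ p, ‖(1 : ℝ × ℝ → ℝ) p‖ ∂(separatedProd μ a b g)) ^ 2 with hM
    have hb : ∀ t, D t ≤ ENNReal.ofReal M * μ univ := fun t => by
      calc D t ≤ ∫⁻ _, ENNReal.ofReal M ∂μ := by
            refine lintegral_mono fun x => ENNReal.ofReal_le_ofReal ?_
            rw [hM]
            gcongr
            exact norm_oscIntegral_le _ _ _ _ _ _
        _ = _ := by simp
    refine ne_top_of_le_ne_top ?_ (lintegral_mono hb)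
    rw [lintegral_const]
    exact ENNReal.mul_ne_top (ENNReal.mul_ne_top ENNReal.ofReal_ne_top (measure_ne_top _ _))
      (by simp)
  have hsum : Summable fun k : ℕ => ((2 : ℝ) ^ k) ^ (-(1 / 4) : ℝ) := by
    have e : ∀ k : ℕ, ((2 : ℝ) ^ k) ^ (-(1 / 4) : ℝ) = ((2 : ℝ) ^ (-(1 / 4) : ℝ)) ^ k := fun k => by
      rw [← Real.rpow_natCast, ← Real.rpow_mul two_pos.le, mul_comm, Real.rpow_mul two_pos.le,
        Real.rpow_natCast]
    simp_rw [e]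
    exact summable_geometric_of_lt_one (by positivity)
      (Real.rpow_lt_one_of_one_lt_of_neg one_lt_two (by norm_num))
  have hhigh : ∑' k, ∫⁻ t in A k, D t ≠ ⊤ := by
    refine ne_top_of_le_ne_top ?_ (ENNReal.tsum_le_tsum fun k =>
      hle ((2 : ℝ) ^ k) (one_le_pow₀ one_le_two))
    rw [ENNReal.tsum_mul_left]
    exact ENNReal.mul_ne_top hC hsum.tsum_ofReal_ne_top
  refine ne_top_of_le_ne_top (ENNReal.add_ne_top.2 ⟨hlow, hhigh⟩) ?_
  calc ∫⁻ t, D t = ∫⁻ t in Icc (-1 : ℝ) 1 ∪ ⋃ k, A k, D t := by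
        rw [hcover, Measure.restrict_univ]
    _ ≤ (∫⁻ t in Icc (-1 : ℝ) 1, D t) + ∫⁻ t in ⋃ k, A k, D t := lintegral_union_le _ _ _
    _ ≤ _ := by gcongr; exact lintegral_iUnion_le _ _

/-- A pin `x` in the support for which the curved projection of the product measure has a square
integrable Fourier transform. -/
lemma exists_lintegral_oscIntegral_ne_top (hμ0 : μ ≠ 0)
    (hμ : ∀ a b : ℝ, a ≤ b → μ (Icc a b) ≤ ENNReal.ofReal ((b - a) ^ (3 / 4 : ℝ)))
    (hg : 0 < g) (hab : |b - a| = 3 * g) {E : Set ℝ} (hE : IsCompact E) (hμE : μ Eᶜ = 0) :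
    ∃ x ∈ E, ∫⁻ t, ENNReal.ofReal (‖oscIntegral (separatedProd μ a b g) (fun p => p.1 + p.2)
      (fun p => p.1 ^ 2 + p.2 ^ 2) 1 x t‖ ^ 2) ≠ ⊤ := by
  obtain ⟨L, hL⟩ := hE.isBounded.subset_closedBall 0
  rw [Real.closedBall_eq_Icc] at hL
  simp only [zero_sub, zero_add] at hL
  have hEae : ∀ᵐ x ∂μ, x ∈ E := hμE
  have hfin := lintegral_lintegral_oscIntegral_ne_top hμ hg hab
    (hEae.mono fun x hx => hL hx)
  have hm : Measurable fun s : ℝ × ℝ => ENNReal.ofReal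
      (‖oscIntegral (separatedProd μ a b g) (fun p => p.1 + p.2)
        (fun p => p.1 ^ 2 + p.2 ^ 2) 1 s.2 s.1‖ ^ 2) :=
    ((continuous_oscIntegral (by fun_prop) (by fun_prop)
      (integrable_const _)).norm.pow 2).measurable.ennreal_ofReal
  -- After the swap the integral over `t` is finite for `μ`-almost every `x`; as `μ` is nonzero and
  -- lives on `E`, one such `x` lies in `E`.
  rw [lintegral_lintegral_swap hm.aemeasurable] at hfin
  have hae := ae_lt_top (hm.comp measurable_swap).lintegral_prod_right' hfin
  have : NeZero μ := ⟨hμ0⟩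
  obtain ⟨x, hx, hx'⟩ := (hEae.and hae).exists
  exact ⟨x, hx, hx'.ne⟩

/-- The pinned box set is the image of a product under a linear projection of
`(y + z, y ^ 2 + z ^ 2)`, up to a locally bi-Lipschitz change of variable. -/
lemma volume_image_eq_zero_of_volume_pinnedBoxSet_eq_zero {E A B : Set ℝ} {x : ℝ} (hA : A ⊆ E)
    (hB : B ⊆ E) (hAB : Disjoint A B) (h : volume (pinnedBoxSet E x) = 0) :
    volume ((fun p : ℝ × ℝ => p.1 ^ 2 + p.2 ^ 2 - 2 * x * (p.1 + p.2)) '' (A ×ˢ B)) = 0 := by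
  -- A differentiable map sends null sets to null sets, so neither injectivity nor measurability of
  -- the box set matters.
  have h1 : volume ((fun t : ℝ => t ^ 2 - 2 * x ^ 2) '' pinnedBoxSet E x) = 0 :=
    addHaar_image_eq_zero_of_differentiableOn_of_addHaar_eq_zero volume
      (Differentiable.differentiableOn (by fun_prop)) h
  refine measure_mono_null ?_ h1
  rintro _ ⟨⟨y, z⟩, ⟨hy, hz⟩, rfl⟩
  refine ⟨_, ⟨y, hA hy, z, hB hz, fun hyz => ?_, rfl⟩, ?_⟩
  · subst hyz
    exact disjoint_left.1 hAB hy hz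
  · dsimp only
    rw [Real.sq_sqrt (by positivity), sq_abs, sq_abs]
    ring

/-- If the box set at the chosen pin were null, the push-forward of the separated product under `f`
would be a nonzero measure on a compact null set, against the square integrability of its
characteristic function. -/
theorem exists_volume_pinnedBoxSet_ne_zero {E : Set ℝ} (hE : IsCompact E)
    (hdim : (3 / 4 : ℝ≥0∞) < dimH E) : ∃ x ∈ E, volume (pinnedBoxSet E x) ≠ 0 := by
  have hH : Measure.hausdorffMeasure (3 / 4 : ℝ) E ≠ 0 := by
    have h := hausdorffMeasure_of_lt_dimH (s := E) (d := 3 / 4) (by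
      have e : ((3 / 4 : ℝ≥0) : ℝ≥0∞) = 3 / 4 := by
        rw [ENNReal.coe_div (by norm_num)]
        norm_num
      rwa [e])
    have e : (((3 / 4 : ℝ≥0) : ℝ)) = 3 / 4 := by norm_num
    rw [e] at h
    rw [h]
    exact ENNReal.top_ne_zero
  obtain ⟨μ, hfin, hμE, hμ0, hμ⟩ :=
    exists_measure_le_rpow_of_hausdorffMeasure_ne_zero (by norm_num) hE hH
  obtain ⟨a, b, g, hg, hab, ha, hb⟩ :=
    exists_separated_intervals_of_measure_singleton_eq_zero hμ0 fun x => by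
      have := hμ x x le_rfl
      simpa using this
  obtain ⟨x, hx, hL2⟩ := exists_lintegral_oscIntegral_ne_top (a := a) (b := b) hμ0 hμ hg hab hE hμE
  refine ⟨x, hx, fun h0 => ?_⟩
  set A := E ∩ Icc (a - g) (a + g) with hA
  set B := E ∩ Icc (b - g) (b + g) with hB
  have hAc : IsCompact A := hE.inter_right isClosed_Icc
  have hBc : IsCompact B := hE.inter_right isClosed_Icc
  have hAB : Disjoint A B := by
    refine disjoint_left.2 fun y hy hy' => ?_
    obtain ⟨-, h1, h2⟩ := hy
    obtain ⟨-, h3, h4⟩ := hy'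
    rcases abs_cases (b - a) with ⟨h, -⟩ | ⟨h, -⟩ <;> linarith
  set f : ℝ × ℝ → ℝ := fun p => p.1 ^ 2 + p.2 ^ 2 - 2 * x * (p.1 + p.2) with hf
  have hfm : Measurable f := by fun_prop
  have hfc : Continuous f := by fun_prop
  set F := separatedProd μ a b g with hF
  have hK : IsCompact (f '' (A ×ˢ B)) := (hAc.prod hBc).image hfc
  refine volume_ne_zero_of_lintegral_charFun_sq_ne_top (ν := F.map f) ?_ hK ?_ ?_
    (volume_image_eq_zero_of_volume_pinnedBoxSet_eq_zero inter_subset_left inter_subset_left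
      hAB h0)
  · rw [Ne, Measure.map_eq_zero_iff hfm.aemeasurable, ← Measure.measure_univ_eq_zero, hF,
      separatedProd, ← univ_prod_univ, Measure.prod_prod, Measure.restrict_apply_univ,
      Measure.restrict_apply_univ]
    exact mul_ne_zero ha hb
  · rw [Measure.map_apply hfm hK.measurableSet.compl]
    have hE1 : ∀ᵐ p ∂F, p ∈ E ×ˢ E := by
      rw [hF, separatedProd_eq_restrict]
      refine ae_restrict_of_ae ?_
      have h1 : ∀ᵐ x ∂μ, x ∈ E := hμE
      exact (Measure.quasiMeasurePreserving_fst.ae h1).and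
        (Measure.quasiMeasurePreserving_snd.ae h1)
    refine measure_mono_null (t := {p | ¬ (p ∈ A ×ˢ B)}) (fun p hp hp' => hp ⟨p, hp', rfl⟩) ?_
    filter_upwards [hE1, ae_mem_separatedProd] with p hp1 hp2
    exact ⟨⟨hp1.1, hp2.1⟩, hp1.2, hp2.2⟩
  -- The characteristic function of the push-forward is the oscillatory integral with amplitude `1`.
  · convert hL2 using 3 with t
    rw [ENNReal.ofReal_pow (norm_nonneg _), ofReal_norm, charFun_apply_real,
      integral_map hfm.aemeasurable (by fun_prop), oscIntegral]
    congr 3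
    ext p
    simp only [Pi.one_apply, Complex.ofReal_one, one_mul, hf]
    push_cast
    rfl

end PinnedBoxSet

/-- A compact set of reals of Hausdorff dimension greater than `3/4` has a box set of positive
Lebesgue measure, and even a pinned box set of positive Lebesgue measure at one of its points. -/
theorem theorem4p1 (E : Set ℝ) (hE : IsCompact E) (hdim : (3 / 4 : ℝ≥0∞) < dimH E) :
    0 < volume (boxSet E) ∧ ∃ x ∈ E, 0 < volume (pinnedBoxSet E x) := by
  obtain ⟨x, hx, h⟩ := exists_volume_pinnedBoxSet_ne_zero hE hdim
  have hpos : 0 < volume (pinnedBoxSet E x) := pos_iff_ne_zero.2 h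
  refine ⟨hpos.trans_le (measure_mono ?_), x, hx, hpos⟩
  rintro t ⟨y, hy, z, hz, hyz, rfl⟩
  exact ⟨x, hx, y, hy, z, hz, hyz, rfl⟩
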